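/- Let $X$, $Y_1$, $Y_2$ be complex manifolds (Hausdorff, each of pure finite dimension, not necessarily compact), let $\phi\colon X\to Y_1\times Y_2$ be a proper surjective holomorphic map, and suppose that $q:=p_{Y_2}\circ\phi\colon X\to Y_2$ is a submersion. Let $V\subset T_X$ be an integrable connection on $q$, i.e. a holomorphic subbundle closed under the Lie bracket such that $T_X=V\oplus T_{X/Y_2}$, where $T_{X/Y_2}=\ker(dq)$. A $V$-leaf is an equivalence class for the relation on $X$ under which two points are equivalent if and only if they are joined by a finite chain of smooth open complex curves tangent to $V$; it carries its leaf topology (generated by the leaves of the restrictions $V|_U$ to open sets $U\subset X$) and its structure of complex manifold for which the inclusion into $X$ is a holomorphic immersion with tangent bundle $V$. Suppose that for every $V$-leaf $\mathfrak V$ there exists $y_1\in Y_1$ such that $\phi(\mathfrak V)=\{y_1\}\times Y_2$. Then the restriction $q|_{\mathfrak V}\colon\mathfrak V\to Y_2$ of $q$ to every $V$-leaf $\mathfrak V$ is an étale covering, i.e. a surjective topological covering map (possibly of infinite degree) that is a local biholomorphism. -/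

import Mathlib

open scoped Manifold ContDiff

/-! Holomorphic foliations on complex manifolds.

A complex manifold is a Hausdorff space with a `ChartedSpace E X` structure over a finite-dimensional
complex normed space `E` such that `IsManifold 𝓘(ℂ, E) ω X`, i.e. the coordinate changes are
(complex) analytic. A holomorphic map is a map of class `ω` over `ℂ`. -/

section HolomorphicFoliation

variable {E : Type*} [NormedAddCommGroup E] [NormedSpace ℂ E]
  {X : Type*} [TopologicalSpace X] [ChartedSpace E X]

/-- `v` is a holomorphic vector field on the open set `U`. -/
def IsHolomorphicVectorFieldOn [IsManifold 𝓘(ℂ, E) ω X]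
    (v : ∀ x : X, TangentSpace 𝓘(ℂ, E) x) (U : Set X) : Prop :=
  ContMDiffOn 𝓘(ℂ, E) 𝓘(ℂ, E).tangent ω (fun x => (⟨x, v x⟩ : TangentBundle 𝓘(ℂ, E) X)) U

/-- A family of subspaces `V x ⊆ T_x X` is a holomorphic subbundle of the tangent bundle:
it has, locally, a frame of holomorphic vector fields. -/
def IsHolomorphicSubbundle [IsManifold 𝓘(ℂ, E) ω X]
    (V : ∀ x : X, Submodule ℂ (TangentSpace 𝓘(ℂ, E) x)) : Prop :=
  ∀ x₀ : X, ∃ U : Set X, IsOpen U ∧ x₀ ∈ U ∧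
    ∃ (k : ℕ) (s : Fin k → ∀ x : X, TangentSpace 𝓘(ℂ, E) x),
      (∀ i, IsHolomorphicVectorFieldOn (s i) U) ∧
      ∀ x ∈ U, LinearIndependent ℂ (fun i => s i x) ∧
        Submodule.span ℂ (Set.range fun i => s i x) = V x

/-- `V` is closed under the Lie bracket: on every open set, the bracket of two holomorphic sections
of `V` is a section of `V`. -/
def IsClosedUnderLieBracket [IsManifold 𝓘(ℂ, E) ω X]
    (V : ∀ x : X, Submodule ℂ (TangentSpace 𝓘(ℂ, E) x)) : Prop :=
  ∀ (U : Set X) (v w : ∀ x : X, TangentSpace 𝓘(ℂ, E) x), IsOpen U →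
    IsHolomorphicVectorFieldOn v U → IsHolomorphicVectorFieldOn w U →
    (∀ x ∈ U, v x ∈ V x) → (∀ x ∈ U, w x ∈ V x) →
    ∀ x ∈ U, VectorField.mlieBracket 𝓘(ℂ, E) v w x ∈ V x

/-- `V` is an integrable connection on `q : X → Y` (which is meant to be a submersion): an integrable
holomorphic subbundle of `T_X` with `T_X = V ⊕ T_{X/Y}`, where `T_{X/Y} = ker (dq)`. -/
structure IsIntegrableConnection [IsManifold 𝓘(ℂ, E) ω X]
    {F : Type*} [NormedAddCommGroup F] [NormedSpace ℂ F]
    {Y : Type*} [TopologicalSpace Y] [ChartedSpace F Y] (q : X → Y)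
    (V : ∀ x : X, Submodule ℂ (TangentSpace 𝓘(ℂ, E) x)) : Prop where
  subbundle : IsHolomorphicSubbundle V
  integrable : IsClosedUnderLieBracket V
  isCompl : ∀ x : X, IsCompl (V x) (mfderiv 𝓘(ℂ, E) 𝓘(ℂ, F) q x).ker

/-- `γ` restricted to the unit disc parametrizes a smooth open (complex) curve in `U ⊆ X` which is
tangent to `V`: it is a holomorphic immersion of the disc into `U` whose velocity lies in `V`. -/
structure IsTangentDisc (V : ∀ x : X, Submodule ℂ (TangentSpace 𝓘(ℂ, E) x)) (U : Set X)
    (γ : ℂ → X) : Prop where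
  holomorphic : ContMDiffOn 𝓘(ℂ, ℂ) 𝓘(ℂ, E) ω γ (Metric.ball 0 1)
  mapsTo : Set.MapsTo γ (Metric.ball 0 1) U
  immersion : ∀ t ∈ Metric.ball (0 : ℂ) 1, mfderiv 𝓘(ℂ, ℂ) 𝓘(ℂ, E) γ t (1 : ℂ) ≠ 0
  tangent : ∀ t ∈ Metric.ball (0 : ℂ) 1, mfderiv 𝓘(ℂ, ℂ) 𝓘(ℂ, E) γ t (1 : ℂ) ∈ V (γ t)

/-- The leaf through `x` of the restricted foliation `V|_U`, for `x` in an open set `U`: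
all points that can be joined to `x` by a finite chain of smooth open curves in `U`
tangent to `V`. (Every connected smooth curve is covered by chains of discs, so it is enough
to use discs as links.) -/
def leafIn (V : ∀ x : X, Submodule ℂ (TangentSpace 𝓘(ℂ, E) x)) (U : Set X) (x : X) : Set X :=
  {y | Relation.ReflTransGen
    (fun a b => ∃ γ : ℂ → X, IsTangentDisc V U γ ∧
      a ∈ γ '' Metric.ball 0 1 ∧ b ∈ γ '' Metric.ball 0 1) x y}

/-- The `V`-leaf through `x`, as a subset of `X`. -/
def leaf (V : ∀ x : X, Submodule ℂ (TangentSpace 𝓘(ℂ, E) x)) (x : X) : Set X :=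
  leafIn V Set.univ x

/-- The `V`-leaf through `x` as a space in its own right; it carries the leaf topology below, not
the topology induced from `X`. -/
structure Leaf (V : ∀ x : X, Submodule ℂ (TangentSpace 𝓘(ℂ, E) x)) (x : X) where
  /-- the underlying point of `X` -/
  pt : X
  mem : pt ∈ leaf V x

/-- The leaf topology: it is generated by the leaves of the restricted foliations `V|_U`, for `U`
open in `X`. Over the domain `U` of a distinguished map these are the plaques. -/
instance (V : ∀ x : X, Submodule ℂ (TangentSpace 𝓘(ℂ, E) x)) (x : X) :
    TopologicalSpace (Leaf V x) :=
  TopologicalSpace.generateFrom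
    {S | ∃ (U : Set X) (y : X), IsOpen U ∧ y ∈ U ∧ S = {p : Leaf V x | p.pt ∈ leafIn V U y}}

/-- A holomorphic atlas on the leaf (compatible with the leaf topology) is the one that the leaf
carries as an immersed submanifold of `X`: the inclusion into `X` is a holomorphic immersion
with tangent spaces `V`. These conditions determine the complex structure of the leaf. -/
structure IsLeafAtlas {F : Type*} [NormedAddCommGroup F] [NormedSpace ℂ F]
    (V : ∀ x : X, Submodule ℂ (TangentSpace 𝓘(ℂ, E) x)) (x : X)
    [ChartedSpace F (Leaf V x)] : Prop where
  isManifold : IsManifold 𝓘(ℂ, F) ω (Leaf V x)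
  holomorphic : ContMDiff 𝓘(ℂ, F) 𝓘(ℂ, E) ω (Leaf.pt : Leaf V x → X)
  immersion : ∀ p : Leaf V x,
    Function.Injective (mfderiv 𝓘(ℂ, F) 𝓘(ℂ, E) (Leaf.pt : Leaf V x → X) p)
  tangent : ∀ p : Leaf V x,
    (mfderiv 𝓘(ℂ, F) 𝓘(ℂ, E) (Leaf.pt : Leaf V x → X) p).range = V p.pt

/-- The restriction of `q : X → Y` to the leaf through `x` is an étale covering: it is a surjective
topological covering (of possibly infinite degree) and, for the complex structure of the leaf, a
local biholomorphism. The space `F` on which `Y` is modelled also serves as model of the leaf. -/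
structure IsEtaleCoveringOnLeaf {F : Type*} [NormedAddCommGroup F] [NormedSpace ℂ F]
    {Y : Type*} [TopologicalSpace Y] [ChartedSpace F Y] (q : X → Y)
    (V : ∀ x : X, Submodule ℂ (TangentSpace 𝓘(ℂ, E) x)) (x : X) : Prop where
  surjective : Function.Surjective fun p : Leaf V x => q p.pt
  isCoveringMap : IsCoveringMap fun p : Leaf V x => q p.pt
  /-- the leaf has its complex structure -/
  exists_atlas : ∃ _ : ChartedSpace F (Leaf V x), IsLeafAtlas (F := F) V x
  /-- `q` restricted to the leaf is étale -/
  isLocalBiholomorphism : ∀ _ : ChartedSpace F (Leaf V x), IsLeafAtlas (F := F) V x →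
    IsLocalDiffeomorph 𝓘(ℂ, F) 𝓘(ℂ, F) ω fun p : Leaf V x => q p.pt

end HolomorphicFoliation

/-!
Fix a leaf, write `q` for the second component of `φ`, and let `y₁` be the point of `Y₁` for which
`φ` maps the leaf onto `{y₁} × Y₂`.

In charts, the subbundle `V` is the image of a *horizontal lift* `H`: the vector of `V` that `dq`
maps to `u` is `H ξ u`, and a section of `q` is tangent to `V` if and only if it solves the total
differential equation `Df = H ∘ f` (`exists_isHorizontalLift`). Closedness under the Lie bracket
says that `DH(ξ)(H(ξ) u) w` is symmetric in `u` and `w` (`IsHorizontalLift.fderiv_symm`), which is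
the integrability condition of this equation. Frobenius' theorem
(`exists_solution_of_symmetric`) then gives, through every point near a given one, a horizontal
section of `q` over a ball whose radius does not depend on the point
(`exists_isHorizontalSection`). It is proved by solving the equation along rays and comparing
neighbouring rays with Grönwall's inequality; the solutions are complex smooth, hence analytic
(`ContDiffOn.analyticOnNhd_of_complex`).

The image of a horizontal section over a ball `B` is a *plaque*. Each of its points is joined
to the centre by a disc over a complex line, and, since curves tangent to `V` are determined by one
of their points and their projection to the base (`eqOn_of_tangent`), a chain of tangent discs over
`B` cannot leave it. So a plaque is exactly a leaf of the restriction of `V` to the part of `X` over `B`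
(`IsHorizontalSection.leafIn_chartTube_eq`). In particular plaques are open in the leaf topology;
the horizontal sections are the inverses of charts of the leaf, and in every admissible complex
structure `q` is a local biholomorphism by the inverse function theorem.

For the covering property, let `y` be a point of `Y₂`. By properness the fibre of `φ` over
`(y₁, y)` is compact, so some `ε > 0` serves as radius for horizontal sections through all
points near this fibre (`IsCompact.exists_isHorizontalSection`), and, again by properness, these
points include all points of the leaf over a neighbourhood of `y`. A section of radius `ε` through a
point whose projection is at distance less than `ε / 2` from `y` reaches the fibre over `y`; hence,
over a small ball around `y`, the leaf is the disjoint union of the plaques through its points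
over `y` (`Leaf.isEvenlyCovered`).
-/

/-! ### Complex smooth maps between Banach spaces are analytic -/

section ComplexAnalyticity

open Metric Set Filter Topology
open scoped Nat

variable {G E : Type*} [NormedAddCommGroup G] [NormedSpace ℂ G]
  [NormedAddCommGroup E] [NormedSpace ℂ E]

/-- **Cauchy estimates** for the iterated derivative of a bounded complex smooth map, obtained by
applying the first order estimate `k` times on balls of radius `h`. -/
theorem norm_iteratedFDeriv_le_of_bounded {f : G → E} {x : G} {R M h : ℝ} (h_pos : 0 < h)
    (hf : ∀ y ∈ ball x R, ContDiffAt ℂ ∞ f y) (hM : ∀ y ∈ ball x R, ‖f y‖ ≤ M) (k : ℕ) :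
    ∀ y, dist y x + k * h < R → ‖iteratedFDeriv ℂ k f y‖ ≤ M * (2 / h) ^ k := by
  induction k with
  | zero =>
    intro y hy
    simpa using hM y (by simpa using hy)
  | succ k ih =>
    intro y hy
    push_cast at hy
    have hsub : ∀ z ∈ ball y h, dist z x + k * h < R := by
      intro z hz
      have := dist_triangle z y x
      rw [mem_ball] at hz
      nlinarith
    have hmem : ∀ z ∈ ball y h, z ∈ ball x R := by
      intro z hz
      have := hsub z hz
      have : 0 ≤ (k : ℝ) * h := by positivity
      rw [mem_ball]
      linarith
    rw [← norm_fderiv_iteratedFDeriv]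
    have key := Complex.norm_fderiv_le_div_of_mapsTo_ball (f := iteratedFDeriv ℂ k f) (c := y)
      (R₁ := h) (R₂ := 2 * (M * (2 / h) ^ k)) ?_ ?_ h_pos
    · refine key.trans (le_of_eq ?_)
      rw [pow_succ]
      ring
    · intro z hz
      exact ((hf z (hmem z hz)).differentiableAt_iteratedFDeriv
        (by exact_mod_cast WithTop.coe_lt_top _)).differentiableWithinAt
    · intro z hz
      rw [mem_closedBall, dist_eq_norm]
      have h1 := ih z (hsub z hz)
      have h2 := ih y (hsub y (mem_ball_self h_pos))
      linarith [norm_sub_le (iteratedFDeriv ℂ k f z) (iteratedFDeriv ℂ k f y)]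

/-- The derivatives of a complex smooth map along a complex line. -/
theorem iteratedDeriv_comp_add_smul {f : G → E} {s : Set G} (hs : IsOpen s)
    (hf : ∀ y ∈ s, ContDiffAt ℂ ∞ f y) (x v : G) (k : ℕ) :
    ∀ t : ℂ, x + t • v ∈ s → iteratedDeriv k (fun t : ℂ => f (x + t • v)) t =
      iteratedFDeriv ℂ k f (x + t • v) fun _ => v := by
  induction k with
  | zero => intro t _; simp
  | succ k ih =>
    intro t ht
    rw [iteratedDeriv_succ, ← ContDiffAt.deriv_fderiv_add_smul
      ((hf _ ht).of_le (by exact_mod_cast le_top))]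
    apply Filter.EventuallyEq.deriv_eq
    have hc : Continuous fun t : ℂ => x + t • v := by fun_prop
    filter_upwards [(hs.preimage hc).mem_nhds ht] with r hr using ih r hr

/-- A complex smooth map between Banach spaces is analytic: the Cauchy estimates bound the Taylor
coefficients, and on every complex line the Taylor series converges to the map. -/
theorem ContDiffOn.analyticOnNhd_of_complex [CompleteSpace E] {f : G → E} {s : Set G}
    (hs : IsOpen s) (hf : ContDiffOn ℂ ∞ f s) : AnalyticOnNhd ℂ f s := by
  intro x hx
  have hfa : ∀ y ∈ s, ContDiffAt ℂ ∞ f y := fun y hy => hf.contDiffAt (hs.mem_nhds hy)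
  obtain ⟨R, hR, hRs, M, hM⟩ : ∃ R > 0, ball x R ⊆ s ∧ ∃ M, ∀ y ∈ ball x R, ‖f y‖ ≤ M := by
    have h1 : ∀ᶠ y in 𝓝 x, ‖f y‖ < ‖f x‖ + 1 :=
      (hfa x hx).continuousAt.norm.eventually_lt_const (by linarith)
    obtain ⟨R, hR, h⟩ := Metric.eventually_nhds_iff_ball.1 (h1.and (hs.mem_nhds hx))
    exact ⟨R, hR, fun y hy => (h y hy).2, ‖f x‖ + 1, fun y hy => (h y hy).1.le⟩
  have hM0 : 0 ≤ M := (norm_nonneg _).trans (hM x (mem_ball_self hR))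
  let p : FormalMultilinearSeries ℂ G E := fun n => (n ! : ℂ)⁻¹ • iteratedFDeriv ℂ n f x
  -- the step `R / (n + 1)` gives `‖p n‖ ≤ M * (2 * (n + 1) / R) ^ n / n! ≤ M * e * (2 * e / R) ^ n`
  set ρ : ℝ := R / (2 * Real.exp 1) with hρ
  have hρ0 : 0 < ρ := by positivity
  have hρR : ρ < R := by
    rw [hρ, div_lt_iff₀ (by positivity)]
    nlinarith [Real.add_one_le_exp 1]
  have hbound : ∀ n : ℕ, ‖p n‖ * ρ ^ n ≤ M * Real.exp 1 := by
    intro n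
    have h1 := norm_iteratedFDeriv_le_of_bounded (h := R / (n + 1)) (by positivity)
      (fun y hy => hfa y (hRs hy)) hM n x (by
        rw [dist_self, zero_add, mul_div_assoc', div_lt_iff₀ (by positivity)]
        nlinarith)
    have h2 : ‖p n‖ ≤ (n ! : ℝ)⁻¹ * (M * (2 / (R / (n + 1))) ^ n) := by
      simp only [p, norm_smul, norm_inv, Complex.norm_natCast]
      gcongr
    have h3 := Real.pow_div_factorial_le_exp (x := (n : ℝ) + 1) (by positivity) n
    calc ‖p n‖ * ρ ^ n ≤ ((n ! : ℝ)⁻¹ * (M * (2 / (R / (n + 1))) ^ n)) * ρ ^ n := by gcongr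
      _ = M * ((((n : ℝ) + 1) ^ n / n !) * ((2 / R) * ρ) ^ n) := by
        rw [mul_pow (2 / R), show (2 / (R / ((n : ℝ) + 1))) = ((n : ℝ) + 1) * (2 / R) by field_simp,
          mul_pow]
        ring
      _ ≤ M * (Real.exp (n + 1) * ((2 / R) * ρ) ^ n) := by gcongr
      _ = M * Real.exp 1 := by
        have : (2 / R) * ρ = Real.exp (-1) := by
          rw [hρ, Real.exp_neg]; field_simp
        rw [this, ← Real.exp_nat_mul, ← Real.exp_add]
        congr 2
        ring
  refine ⟨p, ENNReal.ofReal ρ, ?_, by simpa using hρ0, ?_⟩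
  · exact p.le_radius_of_bound (r := ρ.toNNReal) (M * Real.exp 1)
      fun n => by rw [Real.coe_toNNReal _ hρ0.le]; exact hbound n
  · intro y hy
    have hy' : ‖y‖ < ρ := by
      rw [Metric.eball_ofReal] at hy
      simpa using hy
    -- the line through `x` in the direction `y` stays in the ball for `|t| < R / ρ`
    have hline : ∀ t ∈ ball (0 : ℂ) (R / ρ), x + t • y ∈ ball x R := by
      intro t ht
      rw [mem_ball_zero_iff, lt_div_iff₀ hρ0] at ht
      rw [mem_ball, dist_eq_norm, add_sub_cancel_left, norm_smul]
      exact (mul_le_mul_of_nonneg_left hy'.le (norm_nonneg _)).trans_lt ht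
    have hd : DifferentiableOn ℂ (fun t : ℂ => f (x + t • y)) (ball 0 (R / ρ)) := by
      intro t ht
      have h1 : DifferentiableAt ℂ f (x + t • y) :=
        (hfa _ (hRs (hline t ht))).differentiableAt (by simp)
      exact (h1.comp t (by fun_prop)).differentiableWithinAt
    have h := Complex.hasSum_taylorSeries_on_ball hd (z := 1)
      (by rw [mem_ball_zero_iff, lt_div_iff₀ hρ0]; simpa using hρR)
    simp only [sub_zero, one_pow, one_smul] at h
    convert h using 2 with n
    rw [iteratedDeriv_comp_add_smul hs hfa x y n 0 (by simpa using hx)]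
    simp [p]

/-- A solution of the total differential equation `Df = H ∘ f` with analytic right-hand side is
analytic. -/
theorem ContDiffOn.of_hasFDerivAt_comp [CompleteSpace E] {H : E → G →L[ℂ] E} {Ω : Set E}
    (hH : ContDiffOn ℂ ω H Ω) {f : G → E} {s : Set G} (hs : IsOpen s)
    (hf : ∀ u ∈ s, f u ∈ Ω ∧ HasFDerivAt f (H (f u)) u) : ContDiffOn ℂ ω f s := by
  have hn : ∀ n : ℕ, ContDiffOn ℂ n f s := by
    intro n
    induction n with
    | zero =>
      exact contDiffOn_zero.2 fun u hu => (hf u hu).2.continuousAt.continuousWithinAt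
    | succ n ih =>
      refine (contDiffOn_succ_iff_fderiv_of_isOpen (n := n) hs).2 ⟨fun u hu =>
        (hf u hu).2.differentiableAt.differentiableWithinAt, by simp, ?_⟩
      refine ContDiffOn.congr ((hH.of_le le_top).comp ih fun u hu => (hf u hu).1) fun u hu => ?_
      exact (hf u hu).2.fderiv
  exact (ContDiffOn.analyticOnNhd_of_complex hs (contDiffOn_infty.2 hn)).contDiffOn hs.uniqueDiffOn

end ComplexAnalyticity

/-! ### Total differential equations `Df = H ∘ f` -/

section TotalDifferentialEquation

open Metric Set Filter Topology
open scoped NNReal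

variable {G E : Type*} [NormedAddCommGroup G] [NormedSpace ℂ G]
  [NormedAddCommGroup E] [NormedSpace ℂ E]

/-- Around every point, an analytic field `H` of linear maps is bounded and Lipschitz with
quadratic Taylor remainder. -/
theorem exists_ball_lipschitz_taylor {H : E → G →L[ℂ] E} {Ω : Set E} (hΩ : IsOpen Ω)
    (hH : ContDiffOn ℂ ω H Ω) {x₀ : E} (hx₀ : x₀ ∈ Ω) :
    ∃ r > 0, ball x₀ r ⊆ Ω ∧ ∃ K : ℝ≥0, LipschitzOnWith K H (ball x₀ r) ∧
      (∀ x ∈ ball x₀ r, ‖H x‖ ≤ K) ∧ (∀ x ∈ ball x₀ r, ‖fderiv ℂ H x‖ ≤ K) ∧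
      ∀ x ∈ ball x₀ r, ∀ y ∈ ball x₀ r,
        ‖H y - H x - fderiv ℂ H x (y - x)‖ ≤ K * ‖y - x‖ ^ 2 := by
  have hHx : ContDiffAt ℂ ω H x₀ := hH.contDiffAt (hΩ.mem_nhds hx₀)
  have hD : ContDiffAt ℂ 1 (fderiv ℂ H) x₀ := hHx.fderiv_right le_top
  obtain ⟨K₁, s₁, hs₁, hK₁⟩ := (hHx.of_le (m := 1) le_top).exists_lipschitzOnWith
  obtain ⟨K₂, s₂, hs₂, hK₂⟩ := hD.exists_lipschitzOnWith
  have h1 : ∀ᶠ x in 𝓝 x₀, ‖H x‖ < ‖H x₀‖ + 1 :=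
    hHx.continuousAt.norm.eventually_lt_const (by linarith)
  have h2 : ∀ᶠ x in 𝓝 x₀, ‖fderiv ℂ H x‖ < ‖fderiv ℂ H x₀‖ + 1 :=
    ((continuous_norm.tendsto (fderiv ℂ H x₀)).comp hD.continuousAt.tendsto).eventually_lt_const
      (by linarith)
  obtain ⟨r, hr, h⟩ := Metric.eventually_nhds_iff_ball.1
    ((((h1.and h2).and hs₁).and hs₂).and (hΩ.mem_nhds hx₀))
  let K₃ : ℝ≥0 := (‖H x₀‖ + 1).toNNReal
  let K₄ : ℝ≥0 := (‖fderiv ℂ H x₀‖ + 1).toNNReal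
  refine ⟨r, hr, fun y hy => (h y hy).2, max (max K₁ K₂) (max K₃ K₄), ?_, ?_, ?_, ?_⟩
  · exact (hK₁.mono fun y hy => (h y hy).1.1.2).weaken ((le_max_left _ _).trans (le_max_left _ _))
  · intro x hx
    refine ((h x hx).1.1.1.1.le.trans (Real.le_coe_toNNReal _)).trans ?_
    exact_mod_cast (le_max_left K₃ K₄).trans (le_max_right _ _)
  · intro x hx
    refine ((h x hx).1.1.1.2.le.trans (Real.le_coe_toNNReal _)).trans ?_
    exact_mod_cast (le_max_right K₃ K₄).trans (le_max_right _ _)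
  · intro x hx y hy
    have hseg : segment ℝ x y ⊆ ball x₀ r := (convex_ball x₀ r).segment_subset hx hy
    have hrem : ‖H y - H x - fderiv ℂ H x (y - x)‖ ≤ (K₂ * ‖y - x‖) * ‖y - x‖ := by
      refine (convex_segment x y).norm_image_sub_le_of_norm_fderiv_le' (𝕜 := ℂ)
        (fun z hz => ?_) (fun z hz => ?_) (left_mem_segment ℝ x y) (right_mem_segment ℝ x y)
      · exact (hH.contDiffAt (hΩ.mem_nhds (h z (hseg hz)).2)).differentiableAt (by simp)
      · rw [← dist_eq_norm]
        refine (hK₂.dist_le_mul z (h z (hseg hz)).1.2 x (h x hx).1.2).trans ?_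
        gcongr
        rw [dist_eq_norm]
        exact norm_sub_le_of_mem_segment hz
    refine hrem.trans ?_
    rw [pow_two, ← mul_assoc]
    gcongr
    exact (le_max_right K₁ K₂).trans (le_max_left _ _)

/-- Solutions along rays: for initial values `a` near `x₀` and small `u`, the curve with
`g 0 = a` and `g' = H(g) u` exists on `[0, 1]`. -/
theorem exists_ray_solution [CompleteSpace E] {H : E → G →L[ℂ] E} {x₀ : E} {r : ℝ} (hr : 0 < r)
    {K : ℝ≥0} (hLip : LipschitzOnWith K H (ball x₀ r)) (hK : ∀ x ∈ ball x₀ r, ‖H x‖ ≤ K)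
    {a : E} (ha : a ∈ ball x₀ (r / 4)) {u : G} (hu : K * ‖u‖ ≤ r / 4) :
    ∃ g : ℝ → E, g 0 = a ∧ (∀ t ∈ Icc (0 : ℝ) 1, g t ∈ ball x₀ (3 * r / 4)) ∧
      ∀ t ∈ Icc (0 : ℝ) 1, HasDerivWithinAt g (H (g t) u) (Icc 0 1) t := by
  have hsub : closedBall a (r / 4) ⊆ ball x₀ (3 * r / 4) := by
    intro y hy
    rw [mem_closedBall] at hy
    rw [mem_ball] at ha ⊢
    linarith [dist_triangle y a x₀]
  have hsub' : closedBall a (r / 4) ⊆ ball x₀ r :=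
    hsub.trans (ball_subset_ball (by linarith))
  obtain ⟨ρ, hρ⟩ : ∃ ρ : ℝ≥0, (ρ : ℝ) = r / 4 := ⟨⟨r / 4, by positivity⟩, rfl⟩
  rw [← hρ] at hu hsub hsub'
  have hPL : IsPicardLindelof (fun _ : ℝ => fun x => H x u) (tmin := 0) (tmax := 1)
      ⟨0, by simp⟩ a ρ 0 (K * ‖u‖₊) (K * ‖u‖₊) := by
    apply IsPicardLindelof.of_time_independent
    · intro x hx
      refine ((H x).le_opNorm u).trans ?_
      push_cast
      gcongr
      exact hK x (hsub' hx)
    · refine LipschitzOnWith.of_dist_le_mul fun x hx y hy => ?_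
      rw [dist_eq_norm, ← sub_apply]
      refine ((H x - H y).le_opNorm u).trans ?_
      rw [← dist_eq_norm]
      push_cast
      calc dist (H x) (H y) * ‖u‖ ≤ (K * dist x y) * ‖u‖ := by
            gcongr; exact hLip.dist_le_mul x (hsub' hx) y (hsub' hy)
        _ = K * ‖u‖ * dist x y := by ring
    · simpa using hu
  obtain ⟨α, hα⟩ := ODE.FunSpace.exists_isFixedPt_next hPL (mem_closedBall_self le_rfl)
  have hα0 : α.compProj 0 = a := by
    have := ODE.FunSpace.compProj_val (α := α) (t := ⟨0, by simp⟩)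
    rw [this, ← hα, ODE.FunSpace.next_apply₀]
  refine ⟨α.compProj, hα0, fun t _ => hsub (α.compProj_mem_closedBall hPL.mul_max_le), ?_⟩
  intro t ht
  apply ODE.hasDerivWithinAt_picard_Icc (f := fun _ : ℝ => fun x => H x u) (t₀ := 0)
    (u := closedBall a ρ) (by simp)
    hPL.continuousOn_uncurry α.continuous_compProj.continuousOn
    (fun _ ht' ↦ α.compProj_mem_closedBall hPL.mul_max_le) a ht |>.congr_of_mem _ ht
  intro t' ht'
  nth_rw 1 [← hα]
  rw [ODE.FunSpace.compProj_of_mem ht', ODE.FunSpace.next_apply]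

/-- **Frobenius' theorem** for the total differential equation `Df = H ∘ f`. If `H` is analytic and
`DH(x)(H(x) u) w` is symmetric in `u` and `w`, then all initial value problems `f 0 = a` with `a`
near `x₀` are solvable on a ball whose radius does not depend on `a`.

The solution is `f u = g 1`, where `g` solves `g' = H(g) u` and `g 0 = a`. By the symmetry,
`t ↦ g t + t H(g t) w` solves the equation for `u + w` in place of `u` up to an error `O(‖w‖²)`,
and Grönwall's inequality then gives `f (u + w) = f u + H(f u) w + O(‖w‖²)`. -/
theorem exists_solution_of_symmetric [CompleteSpace E] {H : E → G →L[ℂ] E} {Ω : Set E}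
    (hΩ : IsOpen Ω) (hH : ContDiffOn ℂ ω H Ω)
    (hsymm : ∀ x ∈ Ω, ∀ u w : G, fderiv ℂ H x (H x u) w = fderiv ℂ H x (H x w) u)
    {x₀ : E} (hx₀ : x₀ ∈ Ω) :
    ∃ ε > 0, ∀ᶠ a in 𝓝 x₀, ∃ f : G → E, f 0 = a ∧
      ∀ u ∈ ball (0 : G) ε, f u ∈ Ω ∧ HasFDerivAt f (H (f u)) u := by
  obtain ⟨r, hr, hrΩ, K, hLip, hK, hDK, hT⟩ := exists_ball_lipschitz_taylor hΩ hH hx₀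
  obtain ⟨ε, hε, hKε⟩ : ∃ ε : ℝ, 0 < ε ∧ K * ε ≤ r / 4 := by
    refine ⟨r / 4 / (K + 1), by positivity, ?_⟩
    rw [mul_div_assoc', div_le_iff₀ (by positivity)]
    nlinarith [K.coe_nonneg]
  refine ⟨ε, hε, ?_⟩
  filter_upwards [ball_mem_nhds x₀ (show 0 < r / 4 by positivity)] with a ha
  have hray : ∀ u : G, ∃ g : ℝ → E, ‖u‖ < ε → g 0 = a ∧
      (∀ t ∈ Icc (0 : ℝ) 1, g t ∈ ball x₀ (3 * r / 4)) ∧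
      ∀ t ∈ Icc (0 : ℝ) 1, HasDerivWithinAt g (H (g t) u) (Icc 0 1) t := by
    intro u
    by_cases hu : ‖u‖ < ε
    · obtain ⟨g, hg⟩ := exists_ray_solution hr hLip hK ha (u := u)
        ((mul_le_mul_of_nonneg_left hu.le K.coe_nonneg).trans hKε)
      exact ⟨g, fun _ => hg⟩
    · exact ⟨0, fun h => absurd h hu⟩
  choose g hg using hray
  have hball : ball x₀ (3 * r / 4) ⊆ ball x₀ r := ball_subset_ball (by linarith)
  refine ⟨fun u => g u 1, ?_, ?_⟩
  · -- for `u = 0` the curve is constant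
    obtain ⟨h0, -, hd⟩ := hg 0 (by simpa using hε)
    have := (convex_Icc (0 : ℝ) 1).norm_image_sub_le_of_norm_hasDerivWithin_le (f := g 0)
      (f' := fun t => H (g 0 t) 0) (C := 0) hd (fun t _ => by simp)
      (left_mem_Icc.2 zero_le_one) (right_mem_Icc.2 zero_le_one)
    rw [zero_mul, norm_le_zero_iff, sub_eq_zero, h0] at this
    exact this
  intro u hu
  rw [mem_ball_zero_iff] at hu
  obtain ⟨hu0, huB, hud⟩ := hg u hu
  have h1 : (1 : ℝ) ∈ Icc (0 : ℝ) 1 := right_mem_Icc.2 zero_le_one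
  refine ⟨hrΩ (hball (huB 1 h1)), ?_⟩
  -- the error committed by the approximate solution for `u + w`
  let C : ℝ := K * K + K * K ^ 2 * (2 * ε)
  have hC : 0 ≤ C := by positivity
  have hsmall : ∀ᶠ w in 𝓝 (0 : G), ‖w‖ < ε - ‖u‖ ∧ K * ‖w‖ < r / 4 := by
    refine Filter.Eventually.and ?_ ?_
    · exact continuousAt_id.norm.eventually_lt_const (by simpa using hu)
    · have hc : Continuous fun w : G => K * ‖w‖ := by fun_prop
      refine (hc.tendsto 0).eventually_lt_const ?_
      rw [norm_zero, mul_zero]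
      positivity
  have hmain : ∀ᶠ w in 𝓝 (0 : G), ‖g (u + w) 1 - g u 1 - H (g u 1) w‖ ≤
      gronwallBound 0 (K * ε.toNNReal : ℝ≥0) 1 1 * C * ‖w‖ ^ 2 := by
    filter_upwards [hsmall] with w hw
    have huw : ‖u + w‖ < ε := (norm_add_le u w).trans_lt (by linarith [hw.1])
    obtain ⟨hw0, hwB, hwd⟩ := hg (u + w) huw
    let k : ℝ → E := fun t => g u t + t • H (g u t) w
    let k' : ℝ → E := fun t =>
      H (g u t) u + (t • fderiv ℂ H (g u t) (H (g u t) u) w + (1 : ℝ) • H (g u t) w)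
    have hkB : ∀ t ∈ Icc (0 : ℝ) 1, ‖t • H (g u t) w‖ ≤ K * ‖w‖ := by
      intro t ht
      rw [norm_smul, Real.norm_of_nonneg ht.1]
      calc t * ‖H (g u t) w‖ ≤ 1 * (K * ‖w‖) := by
            refine mul_le_mul ht.2 ?_ (norm_nonneg _) zero_le_one
            refine ((H _).le_opNorm w).trans ?_
            gcongr
            exact hK _ (hball (huB t ht))
        _ = K * ‖w‖ := one_mul _
    have hkmem : ∀ t ∈ Icc (0 : ℝ) 1, k t ∈ ball x₀ r := by
      intro t ht
      have h2 := huB t ht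
      rw [mem_ball, dist_eq_norm] at h2 ⊢
      calc ‖k t - x₀‖ = ‖(g u t - x₀) + t • H (g u t) w‖ := by simp only [k]; congr 1; abel
        _ ≤ ‖g u t - x₀‖ + ‖t • H (g u t) w‖ := norm_add_le _ _
        _ < r := by linarith [hkB t ht, hw.2]
    have hkd : ∀ t ∈ Icc (0 : ℝ) 1, HasDerivWithinAt k (k' t) (Icc 0 1) t := by
      intro t ht
      have hHd : HasFDerivAt H (fderiv ℂ H (g u t)) (g u t) :=
        ((hH.contDiffAt (hΩ.mem_nhds (hrΩ (hball (huB t ht))))).differentiableAt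
          (by simp)).hasFDerivAt
      have h2 : HasDerivWithinAt (fun t => H (g u t)) (fderiv ℂ H (g u t) (H (g u t) u))
          (Icc 0 1) t := (hHd.restrictScalars ℝ).comp_hasDerivWithinAt t (hud t ht)
      have h3 : HasDerivWithinAt (fun t => H (g u t) w) (fderiv ℂ H (g u t) (H (g u t) u) w)
          (Icc 0 1) t :=
        (((ContinuousLinearMap.apply ℂ E w).restrictScalars ℝ).hasFDerivAt).comp_hasDerivWithinAt
          t h2
      exact (hud t ht).add ((hasDerivWithinAt_id t _).smul h3)
    have herr : ∀ t ∈ Icc (0 : ℝ) 1, dist (k' t) (H (k t) (u + w)) ≤ C * ‖w‖ ^ 2 := by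
      intro t ht
      have hx := hball (huB t ht)
      set x := g u t
      set η := t • H x w with hη
      have hkx : k t - x = η := by simp [k, x, hη]
      have hTx := hT x hx (k t) (hkmem t ht)
      rw [hkx] at hTx
      have hid : k' t - H (k t) (u + w) =
          -(fderiv ℂ H x η w) - (H (k t) - H x - fderiv ℂ H x η) (u + w) := by
        have h4 : t • fderiv ℂ H x (H x u) w = fderiv ℂ H x η u := by
          rw [hsymm x (hrΩ hx) u w, hη, (fderiv ℂ H x).map_smul_of_tower]
          rfl
        simp only [k']
        rw [h4]
        simp only [sub_apply, map_add, one_smul]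
        abel
      have hη' := hkB t ht
      rw [dist_eq_norm, hid]
      refine (norm_sub_le _ _).trans ?_
      rw [norm_neg]
      have e1 : ‖fderiv ℂ H x η w‖ ≤ K * (K * ‖w‖) * ‖w‖ := by
        refine ((fderiv ℂ H x η).le_opNorm w).trans ?_
        gcongr
        refine ((fderiv ℂ H x).le_opNorm η).trans ?_
        gcongr
        exact hDK x hx
      have e2 : ‖(H (k t) - H x - fderiv ℂ H x η) (u + w)‖ ≤ K * (K * ‖w‖) ^ 2 * (2 * ε) := by
        refine (ContinuousLinearMap.le_opNorm _ _).trans ?_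
        gcongr
        · exact hTx.trans (by gcongr)
        · linarith
      calc _ ≤ K * (K * ‖w‖) * ‖w‖ + K * (K * ‖w‖) ^ 2 * (2 * ε) := add_le_add e1 e2
        _ = C * ‖w‖ ^ 2 := by simp only [C]; ring
    have hIci : ∀ {h : ℝ → E} {h' : E} {t : ℝ}, t ∈ Ico (0 : ℝ) 1 →
        HasDerivWithinAt h h' (Icc 0 1) t → HasDerivWithinAt h h' (Ici t) t := by
      intro h h' t ht hd
      exact (hd.mono (Icc_subset_Icc_left ht.1)).mono_of_mem_nhdsWithin
        (Icc_mem_nhdsGE ht.2)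
    have hgron := dist_le_of_approx_trajectories_ODE_of_mem (a := 0) (b := 1)
      (f := g (u + w)) (g := k) (v := fun _ x => H x (u + w)) (s := fun _ => ball x₀ r)
      (f' := fun t => H (g (u + w) t) (u + w)) (g' := k') (K := K * ε.toNNReal) (δ := 0)
      (εf := 0) (εg := C * ‖w‖ ^ 2)
      (fun t _ => LipschitzOnWith.of_dist_le_mul fun x hx y hy => by
        rw [dist_eq_norm, ← sub_apply]
        refine ((H x - H y).le_opNorm _).trans ?_
        rw [← dist_eq_norm]
        push_cast
        rw [Real.coe_toNNReal _ hε.le]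
        calc dist (H x) (H y) * ‖u + w‖ ≤ (K * dist x y) * ε := by
              gcongr; exact hLip.dist_le_mul x hx y hy
          _ = K * ε * dist x y := by ring)
      (fun t ht => (hwd t ht).continuousWithinAt)
      (fun t ht => hIci ht (hwd t (Ico_subset_Icc_self ht)))
      (fun t _ => by simp)
      (fun t ht => hball (hwB t (Ico_subset_Icc_self ht)))
      (fun t ht => (hkd t ht).continuousWithinAt)
      (fun t ht => hIci ht (hkd t (Ico_subset_Icc_self ht)))
      (fun t ht => herr t (Ico_subset_Icc_self ht))
      (fun t ht => hkmem t (Ico_subset_Icc_self ht))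
      (by simp [k, hw0, hu0]) 1 h1
    have hlin : ∀ (c L : ℝ), gronwallBound 0 L c 1 = gronwallBound 0 L 1 1 * c := by
      intro c L
      by_cases hL : L = 0
      · simp [hL, gronwallBound_K0]
      · simp [gronwallBound_of_K_ne_0 hL]; ring
    rw [dist_eq_norm, zero_add, sub_zero, hlin] at hgron
    calc ‖g (u + w) 1 - g u 1 - H (g u 1) w‖ = ‖g (u + w) 1 - k 1‖ := by
          simp only [k, one_smul]; congr 1; abel
      _ ≤ _ := by rw [mul_assoc]; exact hgron
  rw [hasFDerivAt_iff_isLittleO_nhds_zero]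
  have hO : (fun w => g (u + w) 1 - g u 1 - H (g u 1) w) =O[𝓝 0] fun w : G => ‖w‖ ^ 2 :=
    Asymptotics.IsBigO.of_bound _ (by simpa using hmain)
  exact hO.trans_isLittleO (Asymptotics.isLittleO_norm_pow_id one_lt_two)

end TotalDifferentialEquation

/-! ### Uniqueness for complex curves -/

section CurveUniqueness

open Metric Set Filter Topology
open scoped NNReal

variable {G E : Type*} [NormedAddCommGroup G] [NormedSpace ℂ G]
  [NormedAddCommGroup E] [NormedSpace ℂ E]

/-- Two complex curves with `γ' = H(γ) c'` that agree at a point agree near it: restricted to real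
segments they are trajectories of the same Lipschitz time-dependent vector field. -/
theorem eventuallyEq_of_hasDerivAt_comp {H : E → G →L[ℂ] E} {Ω : Set E} (hΩ : IsOpen Ω)
    (hH : ContDiffOn ℂ ω H Ω) {γ₁ γ₂ : ℂ → E} {c' : ℂ → G} {t₀ : ℂ} (hc : ContinuousAt c' t₀)
    (h₁ : ∀ᶠ t in 𝓝 t₀, HasDerivAt γ₁ (H (γ₁ t) (c' t)) t)
    (h₂ : ∀ᶠ t in 𝓝 t₀, HasDerivAt γ₂ (H (γ₂ t) (c' t)) t)
    (h0 : γ₁ t₀ = γ₂ t₀) (hmem : γ₁ t₀ ∈ Ω) : γ₁ =ᶠ[𝓝 t₀] γ₂ := by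
  obtain ⟨r, hr, -, K, hLip, -⟩ := exists_ball_lipschitz_taylor hΩ hH hmem
  have hc1 : ∀ᶠ t in 𝓝 t₀, ‖c' t‖ < ‖c' t₀‖ + 1 := hc.norm.eventually_lt_const (by linarith)
  have hm₁ : ∀ᶠ t in 𝓝 t₀, γ₁ t ∈ ball (γ₁ t₀) r :=
    h₁.self_of_nhds.continuousAt.eventually_mem (ball_mem_nhds _ hr)
  have hm₂ : ∀ᶠ t in 𝓝 t₀, γ₂ t ∈ ball (γ₁ t₀) r := by
    rw [h0]
    exact h₂.self_of_nhds.continuousAt.eventually_mem (ball_mem_nhds _ hr)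
  obtain ⟨δ, hδ, h⟩ := Metric.eventually_nhds_iff_ball.1
    (hc1.and ((h₁.and hm₁).and (h₂.and hm₂)))
  filter_upwards [ball_mem_nhds t₀ hδ] with t ht
  -- restrict both curves to the segment from `t₀` to `t`
  let l : ℝ → ℂ := fun s => t₀ + s • (t - t₀)
  have hl : ∀ s ∈ Icc (0 : ℝ) 1, l s ∈ ball t₀ δ := by
    intro s hs
    rw [mem_ball, dist_eq_norm] at ht ⊢
    simp only [l, add_sub_cancel_left, norm_smul, Real.norm_of_nonneg hs.1]
    nlinarith [norm_nonneg (t - t₀), hs.2]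
  have hld : ∀ s : ℝ, HasDerivAt l (t - t₀) s := by
    intro s
    have := ((hasDerivAt_id s).smul_const (t - t₀)).const_add t₀
    rwa [one_smul] at this
  let v : ℝ → E → E := fun s x => (t - t₀) • H x (c' (l s))
  let M : ℝ≥0 := ‖t - t₀‖₊ * (K * (‖c' t₀‖ + 1).toNNReal)
  have hv : ∀ s ∈ Ico (0 : ℝ) 1, LipschitzOnWith M (v s) (ball (γ₁ t₀) r) := by
    intro s hs
    refine LipschitzOnWith.of_dist_le_mul fun x hx y hy => ?_
    have hcs := (h _ (hl s (Ico_subset_Icc_self hs))).1.le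
    have hpos : (0 : ℝ) ≤ ‖c' t₀‖ + 1 := by positivity
    simp only [v, M]
    rw [dist_smul₀, dist_eq_norm (H x _),
      show H x (c' (l s)) - H y (c' (l s)) = (H x - H y) (c' (l s)) from rfl]
    push_cast
    rw [Real.coe_toNNReal _ hpos, mul_assoc]
    gcongr
    refine ((H x - H y).le_opNorm _).trans ?_
    rw [← dist_eq_norm]
    calc dist (H x) (H y) * ‖c' (l s)‖ ≤ (K * dist x y) * (‖c' t₀‖ + 1) := by
          gcongr; exact hLip.dist_le_mul x hx y hy
      _ = K * (‖c' t₀‖ + 1) * dist x y := by ring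
  have hd : ∀ {γ : ℂ → E}, (∀ t ∈ ball t₀ δ, HasDerivAt γ (H (γ t) (c' t)) t) →
      ∀ s ∈ Icc (0 : ℝ) 1, HasDerivAt (fun s => γ (l s)) (v s (γ (l s))) s := by
    intro γ hγ s hs
    exact (hγ _ (hl s hs)).scomp s (hld s)
  have hd₁ := hd fun t ht => (h t ht).2.1.1
  have hd₂ := hd fun t ht => (h t ht).2.2.1
  have := dist_le_of_trajectories_ODE_of_mem (δ := 0) hv
    (fun s hs => (hd₁ s hs).continuousAt.continuousWithinAt)
    (fun s hs => (hd₁ s (Ico_subset_Icc_self hs)).hasDerivWithinAt)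
    (fun s hs => (h _ (hl s (Ico_subset_Icc_self hs))).2.1.2)
    (fun s hs => (hd₂ s hs).continuousAt.continuousWithinAt)
    (fun s hs => (hd₂ s (Ico_subset_Icc_self hs)).hasDerivWithinAt)
    (fun s hs => (h _ (hl s (Ico_subset_Icc_self hs))).2.2.2)
    (by simp [l, h0]) 1 (right_mem_Icc.2 zero_le_one)
  simpa [l] using this

end CurveUniqueness

/-! ### Horizontal lifts in charts -/

section LocalLift

open Set Filter Topology

variable {E G : Type*} [NormedAddCommGroup E] [NormedAddCommGroup G]
  {X Y : Type*} [TopologicalSpace X] [ChartedSpace E X]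
  [TopologicalSpace Y] [ChartedSpace G Y]

/-- The map `q` written in the preferred charts at `x₀` and `q x₀`. -/
def inCharts (q : X → Y) (x₀ : X) : E → G :=
  fun ξ => chartAt G (q x₀) (q ((chartAt E x₀).symm ξ))

/-- The part of the chart at `x₀` that `q` maps to the chart at `q x₀`. -/
def chartDomain (E : Type*) [TopologicalSpace E] (G : Type*) [TopologicalSpace G]
    [ChartedSpace E X] [ChartedSpace G Y] (q : X → Y) (x₀ : X) : Set X :=
  (chartAt E x₀).source ∩ q ⁻¹' (chartAt G (q x₀)).source

theorem isOpen_chartDomain {q : X → Y} (hq : Continuous q) (x₀ : X) :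
    IsOpen (chartDomain E G q x₀) :=
  (chartAt E x₀).open_source.inter ((chartAt G (q x₀)).open_source.preimage hq)

theorem mem_chartDomain (q : X → Y) (x₀ : X) : x₀ ∈ chartDomain E G q x₀ :=
  ⟨mem_chart_source E x₀, mem_chart_source G (q x₀)⟩

variable [NormedSpace ℂ E] [NormedSpace ℂ G]

theorem contDiffOn_inCharts [IsManifold 𝓘(ℂ, E) ω X] [IsManifold 𝓘(ℂ, G) ω Y] {q : X → Y}
    (hq : ContMDiff 𝓘(ℂ, E) 𝓘(ℂ, G) ω q) (x₀ : X) :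
    ContDiffOn ℂ ω (inCharts q x₀ : E → G)
      ((chartAt E x₀).target ∩ (chartAt E x₀).symm ⁻¹' chartDomain E G q x₀) := by
  rw [← contMDiffOn_iff_contDiffOn]
  refine (contMDiffOn_chart (I := 𝓘(ℂ, G)) (x := q x₀)).comp
    (hq.comp_contMDiffOn ((contMDiffOn_chart_symm (I := 𝓘(ℂ, E)) (x := x₀)).mono
      inter_subset_left)) ?_
  intro ξ hξ
  exact hξ.2.2

/-- The chain rule for `ψ ∘ q = (inCharts q x₀) ∘ e`, where `e` and `ψ` are the charts. -/
theorem fderiv_inCharts_mfderiv_chartAt [IsManifold 𝓘(ℂ, E) ω X] [IsManifold 𝓘(ℂ, G) ω Y]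
    {q : X → Y} (hq : ContMDiff 𝓘(ℂ, E) 𝓘(ℂ, G) ω q) {x₀ x : X} (hx : x ∈ chartDomain E G q x₀)
    (v : TangentSpace 𝓘(ℂ, E) x) :
    fderiv ℂ (inCharts q x₀ : E → G) (chartAt E x₀ x)
        (mfderiv 𝓘(ℂ, E) 𝓘(ℂ, E) (chartAt E x₀) x v) =
      mfderiv 𝓘(ℂ, G) 𝓘(ℂ, G) (chartAt G (q x₀)) (q x) (mfderiv 𝓘(ℂ, E) 𝓘(ℂ, G) q x v) := by
  have he : MDifferentiableAt 𝓘(ℂ, E) 𝓘(ℂ, E) (chartAt E x₀) x :=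
    ((contMDiffOn_chart (n := ω)).contMDiffAt
      ((chartAt E x₀).open_source.mem_nhds hx.1)).mdifferentiableAt (by simp)
  have hψ : MDifferentiableAt 𝓘(ℂ, G) 𝓘(ℂ, G) (chartAt G (q x₀)) (q x) :=
    ((contMDiffOn_chart (n := ω)).contMDiffAt
      ((chartAt G (q x₀)).open_source.mem_nhds hx.2)).mdifferentiableAt (by simp)
  have hqx : MDifferentiableAt 𝓘(ℂ, E) 𝓘(ℂ, G) q x := hq.mdifferentiableAt (by simp)
  have hQ : DifferentiableAt ℂ (inCharts q x₀ : E → G) (chartAt E x₀ x) := by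
    have hmem : chartAt E x₀ x ∈ (chartAt E x₀).target ∩
        (chartAt E x₀).symm ⁻¹' chartDomain E G q x₀ :=
      ⟨(chartAt E x₀).map_source hx.1, by
        rw [mem_preimage, (chartAt E x₀).left_inv hx.1]; exact hx⟩
    refine ((contDiffOn_inCharts hq x₀).contDiffAt (IsOpen.mem_nhds ?_ hmem)).differentiableAt
      (by simp)
    exact (chartAt E x₀).symm.isOpen_inter_preimage (isOpen_chartDomain hq.continuous x₀)
  have h1 : HasMFDerivAt 𝓘(ℂ, E) 𝓘(ℂ, G) (inCharts q x₀ ∘ chartAt E x₀) x _ :=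
    (hQ.mdifferentiableAt.hasMFDerivAt).comp x he.hasMFDerivAt
  have h2 := (hψ.hasMFDerivAt).comp x hqx.hasMFDerivAt
  have heq : (chartAt G (q x₀)) ∘ q =ᶠ[𝓝 x] inCharts q x₀ ∘ chartAt E x₀ := by
    filter_upwards [(chartAt E x₀).open_source.mem_nhds hx.1] with z hz
    simp [inCharts, (chartAt E x₀).left_inv hz]
  have h3 := hasMFDerivAt_unique (h1.congr_of_eventuallyEq heq) h2
  have h4 := congrArg (fun L => L v) h3
  rw [← mfderiv_eq_fderiv]
  exact h4

end LocalLift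

section HorizontalLift

open Set Filter Topology

variable {E G : Type*} [NormedAddCommGroup E] [NormedSpace ℂ E]
  [NormedAddCommGroup G] [NormedSpace ℂ G]
  {X Y : Type*} [TopologicalSpace X] [ChartedSpace E X] [IsManifold 𝓘(ℂ, E) ω X]
  [TopologicalSpace Y] [ChartedSpace G Y]

/-- `H` is the horizontal lift of the connection `V` in the charts at `x₀` and `q x₀`, over an open
subset `Ω` of the chart at `x₀`: `H ξ u` is the vector of `V` that `dq` maps to `u`. -/
structure IsHorizontalLift (q : X → Y) (V : ∀ x : X, Submodule ℂ (TangentSpace 𝓘(ℂ, E) x))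
    (x₀ : X) (H : E → G →L[ℂ] E) (Ω : Set E) : Prop where
  isOpen : IsOpen Ω
  mem_target : ∀ ξ ∈ Ω, ξ ∈ (chartAt E x₀).target
  mem_chartDomain : ∀ ξ ∈ Ω, (chartAt E x₀).symm ξ ∈ chartDomain E G q x₀
  contDiffOn : ContDiffOn ℂ ω H Ω
  fderiv_apply : ∀ ξ ∈ Ω, ∀ u, fderiv ℂ (inCharts q x₀ : E → G) ξ (H ξ u) = u
  mem_iff : ∀ x ∈ (chartAt E x₀).source, chartAt E x₀ x ∈ Ω → ∀ v : TangentSpace 𝓘(ℂ, E) x,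
    v ∈ V x ↔ ∃ u, mfderiv 𝓘(ℂ, E) 𝓘(ℂ, E) (chartAt E x₀) x v = H (chartAt E x₀ x) u

theorem mfderiv_chartAt_bijective {x₀ x : X} (hx : x ∈ (chartAt E x₀).source) :
    Function.Bijective (mfderiv 𝓘(ℂ, E) 𝓘(ℂ, E) (chartAt E x₀) x) :=
  have : IsManifold 𝓘(ℂ, E) 1 X := IsManifold.of_le (n := ω) le_top
  (mdifferentiable_chart (I := 𝓘(ℂ, E)) x₀).mfderiv_bijective hx

/-- A holomorphic vector field is holomorphic when written in a chart. -/
theorem IsHolomorphicVectorFieldOn.contDiffOn_chart {v : ∀ x : X, TangentSpace 𝓘(ℂ, E) x}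
    {U : Set X} (hv : IsHolomorphicVectorFieldOn v U) (hU : IsOpen U) {x₀ : X}
    (hU₀ : U ⊆ (chartAt E x₀).source) :
    ContDiffOn ℂ ω (fun ξ : E => (mfderiv 𝓘(ℂ, E) 𝓘(ℂ, E) (chartAt E x₀)
        ((chartAt E x₀).symm ξ) (v ((chartAt E x₀).symm ξ)) : E))
      ((chartAt E x₀).target ∩ (chartAt E x₀).symm ⁻¹' U) := by
  have : IsManifold 𝓘(ℂ, E) 1 X := IsManifold.of_le (n := ω) le_top
  have : IsManifold 𝓘(ℂ, E) (ω + 1) X := ‹IsManifold 𝓘(ℂ, E) ω X›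
  have h1 : ContMDiffOn 𝓘(ℂ, E) 𝓘(ℂ, E) ω
      (fun x => (trivializationAt E (TangentSpace 𝓘(ℂ, E)) x₀ ⟨x, v x⟩).2) U :=
    (Bundle.Trivialization.contMDiffOn_section_iff (n := ω)
      (trivializationAt E (TangentSpace 𝓘(ℂ, E)) x₀) hU (by simpa using hU₀)).1 hv
  have h2 := h1.comp ((contMDiffOn_chart_symm (I := 𝓘(ℂ, E)) (n := ω) (x := x₀)).mono
    (inter_subset_left (t := (chartAt E x₀).symm ⁻¹' U))) fun ξ hξ => hξ.2
  refine contMDiffOn_iff_contDiffOn.1 (h2.congr fun ξ hξ => ?_)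
  have hx : (chartAt E x₀).symm ξ ∈ (chartAt E x₀).source := hU₀ hξ.2
  have h3 := TangentBundle.continuousLinearMapAt_trivializationAt (𝕜 := ℂ) (I := 𝓘(ℂ, E)) hx
  have h4 := congrArg (fun L => L (v ((chartAt E x₀).symm ξ))) h3
  simp only [Function.comp_apply]
  have h5 : ((trivializationAt E (TangentSpace 𝓘(ℂ, E)) x₀).continuousLinearMapAt ℂ
      ((chartAt E x₀).symm ξ)) (v ((chartAt E x₀).symm ξ)) =
      (trivializationAt E (TangentSpace 𝓘(ℂ, E)) x₀
        ⟨(chartAt E x₀).symm ξ, v ((chartAt E x₀).symm ξ)⟩).2 := by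
    rw [Bundle.Trivialization.continuousLinearMapAt_apply,
      Bundle.Trivialization.coe_linearMapAt_of_mem]
    simpa using hx
  rw [← h5]
  exact h4.symm

variable [IsManifold 𝓘(ℂ, G) ω Y]

/-- A holomorphic complement of `ker (dq)` has a holomorphic horizontal lift near every point: if the
columns of `A` are the vectors of a local frame, it is `A ∘ (dq ∘ A)⁻¹`. -/
theorem exists_isHorizontalLift [CompleteSpace E] [CompleteSpace G] {q : X → Y}
    (hq : ContMDiff 𝓘(ℂ, E) 𝓘(ℂ, G) ω q)
    (hsub : ∀ x : X, Function.Surjective (mfderiv 𝓘(ℂ, E) 𝓘(ℂ, G) q x))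
    {V : ∀ x : X, Submodule ℂ (TangentSpace 𝓘(ℂ, E) x)} (hV : IsHolomorphicSubbundle V)
    (hcompl : ∀ x : X, IsCompl (V x) (mfderiv 𝓘(ℂ, E) 𝓘(ℂ, G) q x).ker) (x₀ : X) :
    ∃ (H : E → G →L[ℂ] E) (Ω : Set E), IsHorizontalLift q V x₀ H Ω ∧ chartAt E x₀ x₀ ∈ Ω := by
  obtain ⟨U, hU, hx₀U, k, s, hs, hsV⟩ := hV x₀
  set e := chartAt E x₀ with he
  let U' : Set X := U ∩ chartDomain E G q x₀
  have hU' : IsOpen U' := hU.inter (isOpen_chartDomain hq.continuous x₀)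
  let Ω : Set E := e.target ∩ e.symm ⁻¹' U'
  have hΩ : IsOpen Ω := e.symm.isOpen_inter_preimage hU'
  let S : Fin k → E → E := fun i ξ => mfderiv 𝓘(ℂ, E) 𝓘(ℂ, E) e (e.symm ξ) (s i (e.symm ξ))
  have hS : ∀ i, ContDiffOn ℂ ω (S i) Ω := fun i =>
    IsHolomorphicVectorFieldOn.contDiffOn_chart (v := s i) ((hs i).mono inter_subset_left) hU'
      fun x hx => hx.2.1
  let Q : E → G := inCharts q x₀
  have hQ : ContDiffOn ℂ ω (fderiv ℂ Q) Ω :=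
    ((contDiffOn_inCharts hq x₀).mono fun ξ hξ => ⟨hξ.1, hξ.2.2⟩).fderiv_of_isOpen hΩ le_top
  let A : E → (Fin k → ℂ) →L[ℂ] E := fun ξ =>
    ∑ i, (ContinuousLinearMap.proj (R := ℂ) (φ := fun _ : Fin k => ℂ) i).smulRight (S i ξ)
  have hA : ContDiffOn ℂ ω A Ω := ContDiffOn.sum fun i _ => contDiffOn_const.smulRight (hS i)
  let B : E → (Fin k → ℂ) →L[ℂ] G := fun ξ => (fderiv ℂ Q ξ).comp (A ξ)
  have hB : ContDiffOn ℂ ω B Ω := hQ.clm_comp hA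
  have hAe : ∀ ξ ∈ Ω, ∀ c, A ξ c = mfderiv 𝓘(ℂ, E) 𝓘(ℂ, E) e (e.symm ξ)
      (∑ i, c i • s i (e.symm ξ)) := by
    intro ξ _ c
    simp only [A, S, map_sum, map_smul]
    rw [sum_apply]
    rfl
  have hspan : ∀ ξ ∈ Ω, ∀ v, v ∈ V (e.symm ξ) ↔ ∃ c : Fin k → ℂ, ∑ i, c i • s i (e.symm ξ) = v := by
    intro ξ hξ v
    rw [← (hsV _ hξ.2.1).2, Submodule.mem_span_range_iff_exists_fun]
  have hBe : ∀ ξ ∈ Ω, ∀ v, fderiv ℂ Q ξ (mfderiv 𝓘(ℂ, E) 𝓘(ℂ, E) e (e.symm ξ) v) =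
      mfderiv 𝓘(ℂ, G) 𝓘(ℂ, G) (chartAt G (q x₀)) (q (e.symm ξ))
        (mfderiv 𝓘(ℂ, E) 𝓘(ℂ, G) q (e.symm ξ) v) := by
    intro ξ hξ v
    have := fderiv_inCharts_mfderiv_chartAt hq hξ.2.2 v
    rwa [← he, e.right_inv hξ.1] at this
  have hbij : ∀ ξ ∈ Ω, (B ξ).IsInvertible := by
    intro ξ hξ
    have hψ := mfderiv_chartAt_bijective (E := G) (x₀ := q x₀) hξ.2.2.2
    have hinj : (B ξ).ker = ⊥ := by
      rw [LinearMap.ker_eq_bot']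
      intro c hc
      have h1 : fderiv ℂ Q ξ (A ξ c) = 0 := hc
      rw [hAe ξ hξ, hBe ξ hξ] at h1
      have h2 : mfderiv 𝓘(ℂ, E) 𝓘(ℂ, G) q (e.symm ξ) (∑ i, c i • s i (e.symm ξ)) = 0 :=
        hψ.1 (h1.trans (map_zero _).symm)
      have h3 := Submodule.disjoint_def.1 (hcompl (e.symm ξ)).disjoint _
        ((hspan ξ hξ _).2 ⟨c, rfl⟩) h2
      exact funext (Fintype.linearIndependent_iff.1 (hsV _ hξ.2.1).1 c h3)
    have hsurj : (B ξ).range = ⊤ := by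
      rw [LinearMap.range_eq_top]
      intro g
      obtain ⟨g', hg'⟩ := hψ.2 g
      obtain ⟨z, hz⟩ := hsub (e.symm ξ) g'
      obtain ⟨v, hv, n, hn, hvn⟩ :=
        Submodule.mem_sup.1 ((hcompl (e.symm ξ)).sup_eq_top ▸ Submodule.mem_top (x := z))
      obtain ⟨c, hc⟩ := (hspan ξ hξ v).1 hv
      refine ⟨c, ?_⟩
      change fderiv ℂ Q ξ (A ξ c) = g
      rw [hAe ξ hξ, hBe ξ hξ, hc, ← hg', ← hz, ← hvn, map_add,
        show mfderiv 𝓘(ℂ, E) 𝓘(ℂ, G) q (e.symm ξ) n = 0 from hn, add_zero]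
    exact ⟨ContinuousLinearEquiv.ofBijective (B ξ) hinj hsurj, by ext; rfl⟩
  refine ⟨fun ξ => (A ξ).comp (B ξ).inverse, Ω, ⟨hΩ, fun ξ hξ => hξ.1, fun ξ hξ => hξ.2.2, ?_,
    ?_, ?_⟩, ?_⟩
  · refine hA.clm_comp fun ξ hξ => ?_
    exact ((hbij ξ hξ).contDiffAt_map_inverse).comp_contDiffWithinAt ξ (hB ξ hξ)
  · intro ξ hξ u
    exact (hbij ξ hξ).self_apply_inverse u
  · intro x hx hxΩ v
    have hsymm : e.symm (e x) = x := e.left_inv hx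
    have h1 := hspan (e x) hxΩ
    have h2 := hAe (e x) hxΩ
    rw [hsymm] at h1 h2
    rw [h1]
    constructor
    · rintro ⟨c, rfl⟩
      refine ⟨B (e x) c, ?_⟩
      change _ = A (e x) ((B (e x)).inverse (B (e x) c))
      rw [(hbij _ hxΩ).inverse_apply_self, h2]
    · rintro ⟨u, hu⟩
      refine ⟨(B (e x)).inverse u, (mfderiv_chartAt_bijective hx).1 ?_⟩
      rw [← h2]
      exact hu.symm
  · refine ⟨mem_chart_target E x₀, ?_⟩
    rw [mem_preimage, e.left_inv (mem_chart_source E x₀)]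
    exact ⟨hx₀U, mem_chartDomain q x₀⟩

open VectorField in
/-- For an integrable connection the derivative of the horizontal lift is symmetric. The bracket of
the lifts of two constant fields is a section of `V` and is mapped to zero by `dq`, so it vanishes. -/
theorem IsHorizontalLift.fderiv_symm [CompleteSpace E] {q : X → Y}
    (hq : ContMDiff 𝓘(ℂ, E) 𝓘(ℂ, G) ω q)
    {V : ∀ x : X, Submodule ℂ (TangentSpace 𝓘(ℂ, E) x)} (hV : IsClosedUnderLieBracket V)
    {x₀ : X} {H : E → G →L[ℂ] E} {Ω : Set E} (h : IsHorizontalLift q V x₀ H Ω) {ξ : E} (hξ : ξ ∈ Ω)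
    (u w : G) : fderiv ℂ H ξ (H ξ u) w = fderiv ℂ H ξ (H ξ w) u := by
  set e := chartAt E x₀ with he
  have : IsManifold 𝓘(ℂ, E) (ω + 1) X := ‹IsManifold 𝓘(ℂ, E) ω X›
  let L : G → ∀ ζ : E, TangentSpace 𝓘(ℂ, E) ζ := fun u ζ => H ζ u
  let lift : G → ∀ x : X, TangentSpace 𝓘(ℂ, E) x := fun u =>
    mpullback 𝓘(ℂ, E) 𝓘(ℂ, E) e (L u)
  let U : Set X := e.source ∩ e ⁻¹' Ω
  have hU : IsOpen U := e.isOpen_inter_preimage h.isOpen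
  have hLc : ∀ u, ∀ ζ ∈ Ω, ContDiffAt ℂ ω (fun ζ => H ζ u) ζ := fun u ζ hζ =>
    (h.contDiffOn.contDiffAt (h.isOpen.mem_nhds hζ)).clm_apply contDiffAt_const
  have hLm : ∀ u, ∀ ζ ∈ Ω, ContMDiffAt 𝓘(ℂ, E) 𝓘(ℂ, E).tangent ω
      (fun ζ => (⟨ζ, L u ζ⟩ : TangentBundle 𝓘(ℂ, E) E)) ζ := fun u ζ hζ =>
    contMDiffAt_vectorSpace_iff_contDiffAt.2 (hLc u ζ hζ)
  have hec : ∀ x ∈ U, ContMDiffAt 𝓘(ℂ, E) 𝓘(ℂ, E) ω e x := fun x hx =>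
    (contMDiffOn_chart (n := ω)).contMDiffAt (e.open_source.mem_nhds hx.1)
  have hinv : ∀ x ∈ U, (mfderiv 𝓘(ℂ, E) 𝓘(ℂ, E) e x).IsInvertible := by
    intro x hx
    have : IsManifold 𝓘(ℂ, E) 1 X := IsManifold.of_le (n := ω) le_top
    exact ⟨(mdifferentiable_chart (I := 𝓘(ℂ, E)) x₀).mfderiv hx.1, rfl⟩
  have hlift : ∀ u, IsHolomorphicVectorFieldOn (lift u) U := fun u x hx =>
    (ContMDiffAt.mpullback_vectorField_preimage (hLm u (e x) hx.2) (hec x hx) (hinv x hx)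
      (by simp)).contMDiffWithinAt
  have hliftV : ∀ u, ∀ x ∈ U, lift u x ∈ V x := by
    intro u x hx
    refine (h.mem_iff x hx.1 hx.2 _).2 ⟨u, ?_⟩
    exact (hinv x hx).self_apply_inverse _
  set x := e.symm ξ with hx
  have hex : e x = ξ := e.right_inv (h.mem_target ξ hξ)
  have hxU : x ∈ U := ⟨e.map_target (h.mem_target ξ hξ), by rw [mem_preimage, hex]; exact hξ⟩
  have hbr := hV U (lift u) (lift w) hU (hlift u) (hlift w) (hliftV u) (hliftV w) x hxU
  have hpb := mpullback_mlieBracket (I := 𝓘(ℂ, E)) (I' := 𝓘(ℂ, E)) (n := ω) (x₀ := x)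
    (V := L u) (W := L w)
    ((hLm u (e x) hxU.2).mdifferentiableAt (by simp))
    ((hLm w (e x) hxU.2).mdifferentiableAt (by simp)) (hec x hxU) le_top
  obtain ⟨z, hz⟩ := (h.mem_iff x hxU.1 hxU.2 _).1 hbr
  rw [← hpb] at hz
  have hz' : lieBracket ℂ (L u) (L w) ξ = H ξ z := by
    have h1 : mfderiv 𝓘(ℂ, E) 𝓘(ℂ, E) e x
        (mpullback 𝓘(ℂ, E) 𝓘(ℂ, E) e (mlieBracket 𝓘(ℂ, E) (L u) (L w)) x) =
        mlieBracket 𝓘(ℂ, E) (L u) (L w) (e x) := (hinv x hxU).self_apply_inverse _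
    rw [← he, h1, ← mlieBracketWithin_univ, mlieBracketWithin_eq_lieBracketWithin,
      lieBracketWithin_univ, hex] at hz
    exact hz
  have hHd : DifferentiableAt ℂ H ξ :=
    (h.contDiffOn.contDiffAt (h.isOpen.mem_nhds hξ)).differentiableAt (by simp)
  have hLd : ∀ (u : G) (v : E), fderiv ℂ (fun ζ => H ζ u) ξ v = fderiv ℂ H ξ v u := by
    intro u v
    rw [fderiv_clm_apply hHd (differentiableAt_const _)]
    simp
  have hz'' : fderiv ℂ H ξ (H ξ u) w - fderiv ℂ H ξ (H ξ w) u = H ξ z := by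
    rw [← hz', ← hLd, ← hLd]
    rfl
  -- differentiate `dQ (H u) = u` along `H w` and use the symmetry of the second derivative of `Q`
  let Q : E → G := inCharts q x₀
  have hQ : ContDiffAt ℂ ω Q ξ :=
    ((contDiffOn_inCharts hq x₀).mono fun ζ (hζ : ζ ∈ Ω) =>
      ⟨h.mem_target ζ hζ, h.mem_chartDomain ζ hζ⟩).contDiffAt (h.isOpen.mem_nhds hξ)
  have hQ' : DifferentiableAt ℂ (fderiv ℂ Q) ξ :=
    (hQ.fderiv_right (m := ω) le_top).differentiableAt (by simp)
  have hsymm := hQ.isSymmSndFDerivAt (by simp)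
  have hdiff : ∀ u v, fderiv ℂ (fderiv ℂ Q) ξ v (H ξ u) + fderiv ℂ Q ξ (fderiv ℂ H ξ v u) = 0 := by
    intro u v
    have h1 : (fun ζ => fderiv ℂ Q ζ (H ζ u)) =ᶠ[𝓝 ξ] fun _ => u := by
      filter_upwards [h.isOpen.mem_nhds hξ] with ζ hζ using h.fderiv_apply ζ hζ u
    have h2 := h1.fderiv_eq (𝕜 := ℂ)
    rw [fderiv_clm_apply hQ' ((hLc u ξ hξ).differentiableAt (by simp))] at h2
    have h3 := congrArg (fun T => T v) h2
    simp only [fderiv_fun_const, Pi.zero_apply, zero_apply, add_apply,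
      ContinuousLinearMap.comp_apply, ContinuousLinearMap.flip_apply, hLd] at h3
    rw [add_comm]
    exact h3
  have hz0 : z = 0 := by
    rw [← h.fderiv_apply ξ hξ z, ← hz'', map_sub, sub_eq_zero]
    have h1 := hdiff w (H ξ u)
    have h2 := hdiff u (H ξ w)
    rw [hsymm (H ξ u) (H ξ w)] at h1
    exact add_left_cancel (h1.trans h2.symm)
  rwa [hz0, map_zero, sub_eq_zero] at hz''

end HorizontalLift

/-! ### Horizontal sections -/

section HorizontalSection

open Set Filter Topology Metric

variable {E G : Type*} [NormedAddCommGroup E] [NormedSpace ℂ E]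
  [NormedAddCommGroup G] [NormedSpace ℂ G]
  {X Y : Type*} [TopologicalSpace X] [ChartedSpace E X]
  [TopologicalSpace Y] [ChartedSpace G Y]

/-- `f` is a holomorphic section of `q` over `B`, tangent to `V`. Here `B` is a subset of the model
space `G`, which is identified with a subset of `Y` by the preferred chart at `y₀`. -/
structure IsHorizontalSection (q : X → Y) (V : ∀ x : X, Submodule ℂ (TangentSpace 𝓘(ℂ, E) x))
    (y₀ : Y) (f : G → X) (B : Set G) : Prop where
  contMDiffOn : ContMDiffOn 𝓘(ℂ, G) 𝓘(ℂ, E) ω f B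
  mem_source : ∀ y ∈ B, q (f y) ∈ (chartAt G y₀).source
  apply_eq : ∀ y ∈ B, chartAt G y₀ (q (f y)) = y
  tangent : ∀ y ∈ B, ∀ u, mfderiv 𝓘(ℂ, G) 𝓘(ℂ, E) f y u ∈ V (f y)

theorem IsHorizontalSection.mono {q : X → Y} {V : ∀ x : X, Submodule ℂ (TangentSpace 𝓘(ℂ, E) x)}
    {y₀ : Y} {f : G → X} {B B' : Set G} (h : IsHorizontalSection q V y₀ f B) (hB : B' ⊆ B) :
    IsHorizontalSection q V y₀ f B' :=
  ⟨h.contMDiffOn.mono hB, fun y hy => h.mem_source y (hB hy), fun y hy => h.apply_eq y (hB hy),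
    fun y hy => h.tangent y (hB hy)⟩

variable [IsManifold 𝓘(ℂ, G) ω Y]

/-- The derivative of a horizontal section is a right inverse of that of `q` (in the chart). -/
theorem IsHorizontalSection.mfderiv_chartAt_comp_apply {q : X → Y}
    (hq : ContMDiff 𝓘(ℂ, E) 𝓘(ℂ, G) ω q)
    {V : ∀ x : X, Submodule ℂ (TangentSpace 𝓘(ℂ, E) x)} {y₀ : Y} {f : G → X} {B : Set G}
    (hB : IsOpen B) (h : IsHorizontalSection q V y₀ f B) {y : G} (hy : y ∈ B) (u : G) :
    mfderiv 𝓘(ℂ, G) 𝓘(ℂ, G) (chartAt G y₀) (q (f y)) (mfderiv 𝓘(ℂ, E) 𝓘(ℂ, G) q (f y)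
      (mfderiv 𝓘(ℂ, G) 𝓘(ℂ, E) f y u)) = u := by
  have hf : MDifferentiableAt 𝓘(ℂ, G) 𝓘(ℂ, E) f y :=
    (h.contMDiffOn.contMDiffAt (hB.mem_nhds hy)).mdifferentiableAt (by simp)
  have hqf : MDifferentiableAt 𝓘(ℂ, E) 𝓘(ℂ, G) q (f y) := hq.mdifferentiableAt (by simp)
  have hψ : MDifferentiableAt 𝓘(ℂ, G) 𝓘(ℂ, G) (chartAt G y₀) (q (f y)) :=
    ((contMDiffOn_chart (n := ω)).contMDiffAt ((chartAt G y₀).open_source.mem_nhds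
      (h.mem_source y hy))).mdifferentiableAt (by simp)
  have h1 := (hψ.hasMFDerivAt.comp (f y) hqf.hasMFDerivAt).comp y hf.hasMFDerivAt
  have h2 : (id : G → G) =ᶠ[𝓝 y] (chartAt G y₀ ∘ q) ∘ f := by
    filter_upwards [hB.mem_nhds hy] with z hz using (h.apply_eq z hz).symm
  have h3 := hasMFDerivAt_unique (h1.congr_of_eventuallyEq h2) (hasMFDerivAt_id y)
  exact congrArg (fun L => L u) h3

theorem IsHorizontalSection.mfderiv_injective {q : X → Y} (hq : ContMDiff 𝓘(ℂ, E) 𝓘(ℂ, G) ω q)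
    {V : ∀ x : X, Submodule ℂ (TangentSpace 𝓘(ℂ, E) x)} {y₀ : Y} {f : G → X} {B : Set G}
    (hB : IsOpen B) (h : IsHorizontalSection q V y₀ f B) {y : G} (hy : y ∈ B) :
    Function.Injective (mfderiv 𝓘(ℂ, G) 𝓘(ℂ, E) f y) := by
  intro u w huw
  have h1 := h.mfderiv_chartAt_comp_apply hq hB hy u
  rw [huw] at h1
  exact h1.symm.trans (h.mfderiv_chartAt_comp_apply hq hB hy w)

/-- The tangent spaces of the image of a horizontal section are the spaces `V`. -/
theorem IsHorizontalSection.range_mfderiv {q : X → Y} (hq : ContMDiff 𝓘(ℂ, E) 𝓘(ℂ, G) ω q)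
    {V : ∀ x : X, Submodule ℂ (TangentSpace 𝓘(ℂ, E) x)}
    (hcompl : ∀ x : X, IsCompl (V x) (mfderiv 𝓘(ℂ, E) 𝓘(ℂ, G) q x).ker)
    {y₀ : Y} {f : G → X} {B : Set G} (hB : IsOpen B) (h : IsHorizontalSection q V y₀ f B)
    {y : G} (hy : y ∈ B) : (mfderiv 𝓘(ℂ, G) 𝓘(ℂ, E) f y).range = V (f y) := by
  refine le_antisymm (by rintro _ ⟨u, rfl⟩; exact h.tangent y hy u) fun v hv => ?_
  let u : G := mfderiv 𝓘(ℂ, G) 𝓘(ℂ, G) (chartAt G y₀) (q (f y)) (mfderiv 𝓘(ℂ, E) 𝓘(ℂ, G) q (f y) v)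
  refine ⟨u, ?_⟩
  have h1 := h.mfderiv_chartAt_comp_apply hq hB hy u
  have h2 := (mfderiv_chartAt_bijective (E := G) (h.mem_source y hy)).1 h1
  have h3 := Submodule.disjoint_def.1 (hcompl (f y)).disjoint
    (mfderiv 𝓘(ℂ, G) 𝓘(ℂ, E) f y u - v) ((V (f y)).sub_mem (h.tangent y hy u) hv)
    (by
      change mfderiv 𝓘(ℂ, E) 𝓘(ℂ, G) q (f y) (mfderiv 𝓘(ℂ, G) 𝓘(ℂ, E) f y u - v) = 0
      rw [map_sub, h2, sub_self])
  exact sub_eq_zero.1 h3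

variable [IsManifold 𝓘(ℂ, E) ω X]

/-- Through every point near `x₀` there is a horizontal section over a ball of fixed radius. -/
theorem exists_isHorizontalSection [CompleteSpace E] [CompleteSpace G] {q : X → Y}
    (hq : ContMDiff 𝓘(ℂ, E) 𝓘(ℂ, G) ω q)
    (hsub : ∀ x : X, Function.Surjective (mfderiv 𝓘(ℂ, E) 𝓘(ℂ, G) q x))
    {V : ∀ x : X, Submodule ℂ (TangentSpace 𝓘(ℂ, E) x)}
    (hV : IsIntegrableConnection (F := G) q V) (x₀ : X) :
    ∃ ε > 0, ∀ᶠ a in 𝓝 x₀, ∃ f : G → X, f (chartAt G (q x₀) (q a)) = a ∧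
      IsHorizontalSection q V (q x₀) f (ball (chartAt G (q x₀) (q a)) ε) := by
  obtain ⟨H, Ω, hH, hx₀⟩ := exists_isHorizontalLift hq hsub hV.subbundle hV.isCompl x₀
  obtain ⟨ε, hε, hsol⟩ := exists_solution_of_symmetric hH.isOpen hH.contDiffOn
    (fun ξ hξ => hH.fderiv_symm hq hV.integrable hξ) hx₀
  refine ⟨ε, hε, ?_⟩
  set e := chartAt E x₀ with he
  set ψ := chartAt G (q x₀) with hψ
  have hec : ContinuousAt e x₀ := e.continuousAt (mem_chart_source E x₀)
  filter_upwards [hec.eventually hsol, e.open_source.mem_nhds (mem_chart_source E x₀)]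
    with a ⟨F, hF0, hF⟩ ha
  let c : G := ψ (q a)
  have hshift : ∀ y ∈ ball c ε, y - c ∈ ball (0 : G) ε := fun y hy => by
    simpa [dist_eq_norm] using hy
  have hFc : ContDiffOn ℂ ω F (ball 0 ε) :=
    ContDiffOn.of_hasFDerivAt_comp hH.contDiffOn isOpen_ball hF
  have hFc' : ContDiffOn ℂ ω (fun y => F (y - c)) (ball c ε) :=
    hFc.comp (contDiff_id.sub contDiff_const).contDiffOn hshift
  have hΩ : ∀ y ∈ ball c ε, F (y - c) ∈ Ω := fun y hy => (hF _ (hshift y hy)).1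
  have hef : ∀ y ∈ ball c ε, e (e.symm (F (y - c))) = F (y - c) := fun y hy =>
    e.right_inv (hH.mem_target _ (hΩ y hy))
  have hfm : ContMDiffOn 𝓘(ℂ, G) 𝓘(ℂ, E) ω (fun y => e.symm (F (y - c))) (ball c ε) :=
    (contMDiffOn_chart_symm (I := 𝓘(ℂ, E)) (n := ω) (x := x₀)).comp hFc'.contMDiffOn
      fun y hy => hH.mem_target _ (hΩ y hy)
  -- `q ∘ f` has derivative `id` in the charts
  have hQF : ∀ u ∈ ball (0 : G) ε, inCharts q x₀ (F u) = c + u := by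
    intro u hu
    have hd : ∀ v ∈ ball (0 : G) ε, HasFDerivAt (fun v => (inCharts q x₀ : E → G) (F v))
        (ContinuousLinearMap.id ℂ G) v := by
      intro v hv
      have h1 : DifferentiableAt ℂ (inCharts q x₀ : E → G) (F v) :=
        (((contDiffOn_inCharts hq x₀).mono fun ζ (hζ : ζ ∈ Ω) =>
          ⟨hH.mem_target ζ hζ, hH.mem_chartDomain ζ hζ⟩).contDiffAt
            (hH.isOpen.mem_nhds (hF v hv).1)).differentiableAt (by simp)
      have h2 := h1.hasFDerivAt.comp v (hF v hv).2
      refine h2.congr_fderiv ?_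
      ext w
      exact hH.fderiv_apply _ (hF v hv).1 w
    have h0 := (convex_ball (0 : G) ε).norm_image_sub_le_of_norm_hasFDerivWithin_le'
      (φ := ContinuousLinearMap.id ℂ G) (C := 0) (fun v hv => (hd v hv).hasFDerivWithinAt)
      (fun v _ => by simp) (mem_ball_self hε) hu
    rw [zero_mul, norm_le_zero_iff, sub_eq_zero, hF0] at h0
    have h1 : inCharts q x₀ (e a) = c := by
      simp only [inCharts, ← he, e.left_inv ha, c, hψ]
    rw [h1] at h0
    simpa [sub_eq_iff_eq_add'] using h0
  refine ⟨fun y => e.symm (F (y - c)), ?_, hfm, ?_, ?_, ?_⟩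
  · change e.symm (F (c - c)) = a
    rw [sub_self, hF0, e.left_inv ha]
  · intro y hy
    exact (hH.mem_chartDomain _ (hΩ y hy)).2
  · intro y hy
    have := hQF _ (hshift y hy)
    rwa [add_sub_cancel] at this
  · intro y hy u
    have hx : e.symm (F (y - c)) ∈ e.source := e.map_target (hH.mem_target _ (hΩ y hy))
    refine (hH.mem_iff _ hx (by rw [← he, hef y hy]; exact hΩ y hy) _).2 ⟨u, ?_⟩
    have hfd : MDifferentiableAt 𝓘(ℂ, G) 𝓘(ℂ, E) (fun y => e.symm (F (y - c))) y :=
      (hfm.contMDiffAt (isOpen_ball.mem_nhds hy)).mdifferentiableAt (by simp)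
    have hed : MDifferentiableAt 𝓘(ℂ, E) 𝓘(ℂ, E) e (e.symm (F (y - c))) :=
      ((contMDiffOn_chart (n := ω)).contMDiffAt (e.open_source.mem_nhds hx)).mdifferentiableAt
        (by simp)
    have h1 := hed.hasMFDerivAt.comp y hfd.hasMFDerivAt
    have h2 : HasFDerivAt (fun y => F (y - c)) (H (F (y - c))) y := by
      have := (hF _ (hshift y hy)).2.comp y ((hasFDerivAt_id y).sub_const c)
      simpa using! this
    have h3 : (fun y => F (y - c)) =ᶠ[𝓝 y] e ∘ fun y => e.symm (F (y - c)) := by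
      filter_upwards [isOpen_ball.mem_nhds hy] with z hz using (hef z hz).symm
    have h4 := hasMFDerivAt_unique (h1.congr_of_eventuallyEq h3) h2.hasMFDerivAt
    have h5 := congrArg (fun L => L u) h4
    rw [← he, hef y hy]
    exact h5

/-- In a chart a curve tangent to `V` solves the differential equation given by the horizontal
lift. -/
theorem IsHorizontalLift.hasDerivAt_chart {q : X → Y} (hq : ContMDiff 𝓘(ℂ, E) 𝓘(ℂ, G) ω q)
    {V : ∀ x : X, Submodule ℂ (TangentSpace 𝓘(ℂ, E) x)} {x₀ : X} {H : E → G →L[ℂ] E} {Ω : Set E}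
    (h : IsHorizontalLift q V x₀ H Ω) {γ : ℂ → X} {t : ℂ}
    (hγ : MDifferentiableAt 𝓘(ℂ, ℂ) 𝓘(ℂ, E) γ t)
    (hγV : mfderiv 𝓘(ℂ, ℂ) 𝓘(ℂ, E) γ t (1 : ℂ) ∈ V (γ t))
    (hs : γ t ∈ (chartAt E x₀).source) (hΩ : chartAt E x₀ (γ t) ∈ Ω) :
    HasDerivAt (fun t => chartAt E x₀ (γ t))
      (H (chartAt E x₀ (γ t)) (deriv (fun t => chartAt G (q x₀) (q (γ t))) t)) t := by
  set e := chartAt E x₀ with he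
  obtain ⟨u, hu⟩ := (h.mem_iff _ hs hΩ _).1 hγV
  have hed : MDifferentiableAt 𝓘(ℂ, E) 𝓘(ℂ, E) e (γ t) :=
    ((contMDiffOn_chart (n := ω)).contMDiffAt (e.open_source.mem_nhds hs)).mdifferentiableAt
      (by simp)
  have h1 : HasDerivAt (fun t => e (γ t)) (H (e (γ t)) u) t := by
    let D : ℂ →L[ℂ] E := (mfderiv 𝓘(ℂ, E) 𝓘(ℂ, E) e (γ t)).comp (mfderiv 𝓘(ℂ, ℂ) 𝓘(ℂ, E) γ t)
    have h2 : HasFDerivAt (fun t => e (γ t)) D t :=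
      (hed.hasMFDerivAt.comp t hγ.hasMFDerivAt).hasFDerivAt
    exact h2.hasDerivAt.congr_deriv hu
  have h4 : HasDerivAt (fun t => chartAt G (q x₀) (q (γ t))) u t := by
    have h5 : DifferentiableAt ℂ (inCharts q x₀ : E → G) (e (γ t)) :=
      (((contDiffOn_inCharts hq x₀).mono fun ζ (hζ : ζ ∈ Ω) =>
        ⟨h.mem_target ζ hζ, h.mem_chartDomain ζ hζ⟩).contDiffAt
          (h.isOpen.mem_nhds hΩ)).differentiableAt (by simp)
    have h6 := h5.hasFDerivAt.comp_hasDerivAt t h1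
    rw [h.fderiv_apply _ hΩ] at h6
    refine h6.congr_of_eventuallyEq ?_
    filter_upwards [hγ.continuousAt (e.open_source.mem_nhds hs)] with s hs
    simp only [Function.comp_apply, inCharts, ← he]
    rw [e.left_inv hs]
  rw [h4.deriv]
  exact h1

/-- **Uniqueness of horizontal lifts**: two curves tangent to `V` with the same projection to `Y`
that meet at one parameter value coincide. -/
theorem eqOn_of_tangent [T2Space X] [CompleteSpace E] [CompleteSpace G] {q : X → Y}
    (hq : ContMDiff 𝓘(ℂ, E) 𝓘(ℂ, G) ω q)
    (hsub : ∀ x : X, Function.Surjective (mfderiv 𝓘(ℂ, E) 𝓘(ℂ, G) q x))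
    {V : ∀ x : X, Submodule ℂ (TangentSpace 𝓘(ℂ, E) x)}
    (hV : IsIntegrableConnection (F := G) q V) {S : Set ℂ} (hS : IsOpen S)
    (hSc : IsPreconnected S) {γ₁ γ₂ : ℂ → X} (h₁ : ContMDiffOn 𝓘(ℂ, ℂ) 𝓘(ℂ, E) ω γ₁ S)
    (h₂ : ContMDiffOn 𝓘(ℂ, ℂ) 𝓘(ℂ, E) ω γ₂ S)
    (hV₁ : ∀ t ∈ S, mfderiv 𝓘(ℂ, ℂ) 𝓘(ℂ, E) γ₁ t (1 : ℂ) ∈ V (γ₁ t))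
    (hV₂ : ∀ t ∈ S, mfderiv 𝓘(ℂ, ℂ) 𝓘(ℂ, E) γ₂ t (1 : ℂ) ∈ V (γ₂ t))
    (hq' : ∀ t ∈ S, q (γ₁ t) = q (γ₂ t)) {t₀ : ℂ} (ht₀ : t₀ ∈ S) (h0 : γ₁ t₀ = γ₂ t₀) :
    EqOn γ₁ γ₂ S := by
  have hloc : ∀ t ∈ S, γ₁ t = γ₂ t → γ₁ =ᶠ[𝓝 t] γ₂ := by
    intro t ht heq
    obtain ⟨H, Ω, hH, hx₀⟩ := exists_isHorizontalLift hq hsub hV.subbundle hV.isCompl (γ₁ t)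
    set e := chartAt E (γ₁ t) with he
    have hSn : S ∈ 𝓝 t := hS.mem_nhds ht
    have hd₁ : ∀ s ∈ S, MDifferentiableAt 𝓘(ℂ, ℂ) 𝓘(ℂ, E) γ₁ s := fun s hs =>
      (h₁.contMDiffAt (hS.mem_nhds hs)).mdifferentiableAt (by simp)
    have hd₂ : ∀ s ∈ S, MDifferentiableAt 𝓘(ℂ, ℂ) 𝓘(ℂ, E) γ₂ s := fun s hs =>
      (h₂.contMDiffAt (hS.mem_nhds hs)).mdifferentiableAt (by simp)
    have hnhds : e.source ∩ e ⁻¹' Ω ∈ 𝓝 (γ₁ t) :=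
      (e.isOpen_inter_preimage hH.isOpen).mem_nhds ⟨mem_chart_source E _, hx₀⟩
    have hm₁ : ∀ᶠ s in 𝓝 t, γ₁ s ∈ e.source ∩ e ⁻¹' Ω := (hd₁ t ht).continuousAt hnhds
    have hm₂ : ∀ᶠ s in 𝓝 t, γ₂ s ∈ e.source ∩ e ⁻¹' Ω :=
      (hd₂ t ht).continuousAt (heq ▸ hnhds)
    let c : ℂ → G := fun s => chartAt G (q (γ₁ t)) (q (γ₁ s))
    have hc : ContDiffAt ℂ ω c t := by
      rw [← contMDiffAt_iff_contDiffAt]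
      exact ((contMDiffOn_chart (n := ω)).contMDiffAt ((chartAt G (q (γ₁ t))).open_source.mem_nhds
        (mem_chart_source G _))).comp t (hq.contMDiffAt.comp t (h₁.contMDiffAt hSn))
    have hc' : ContinuousAt (deriv c) t :=
      (hc.fderiv_right (m := ω) le_top).continuousAt.clm_apply continuousAt_const
    have hS' : ∀ᶠ s in 𝓝 t, s ∈ S := hSn
    have key : (fun s => e (γ₁ s)) =ᶠ[𝓝 t] fun s => e (γ₂ s) := by
      refine eventuallyEq_of_hasDerivAt_comp hH.isOpen hH.contDiffOn hc' ?_ ?_ (by rw [heq]) hx₀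
      · filter_upwards [hm₁, hS'] with s hs hsS
        exact hH.hasDerivAt_chart hq (hd₁ s hsS) (hV₁ s hsS) hs.1 hs.2
      · filter_upwards [hm₂, hS'] with s hs hsS
        have := hH.hasDerivAt_chart hq (hd₂ s hsS) (hV₂ s hsS) hs.1 hs.2
        have hcs : deriv (fun s => chartAt G (q (γ₁ t)) (q (γ₂ s))) s = deriv c s := by
          refine Filter.EventuallyEq.deriv_eq ?_
          filter_upwards [hS.mem_nhds hsS] with r hr
          simp only [c, hq' r hr]
        rwa [hcs] at this
    filter_upwards [key, hm₁, hm₂] with s hs hs₁ hs₂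
    exact e.injOn hs₁.1 hs₂.1 hs
  have hsub' : S ⊆ {t | γ₁ =ᶠ[𝓝 t] γ₂} := by
    refine hSc.subset_of_closure_inter_subset isOpen_setOfPred_eventually_nhds
      ⟨t₀, ht₀, hloc t₀ ht₀ h0⟩ ?_
    rintro t ⟨htc, ht⟩
    refine hloc t ht ?_
    have hf : ∃ᶠ s in 𝓝 t, γ₁ s = γ₂ s :=
      (mem_closure_iff_frequently.1 htc).mono fun s hs => hs.self_of_nhds
    exact tendsto_nhds_unique_of_frequently_eq
      (h₁.continuousOn.continuousAt (hS.mem_nhds ht))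
      (h₂.continuousOn.continuousAt (hS.mem_nhds ht)) hf
  exact fun t ht => (hsub' ht).self_of_nhds

end HorizontalSection

/-! ### Plaques -/

section Plaque

open Set Filter Topology Metric

variable {E G : Type*} [NormedAddCommGroup E] [NormedSpace ℂ E]
  [NormedAddCommGroup G]
  {X Y : Type*} [TopologicalSpace X] [ChartedSpace E X]
  [TopologicalSpace Y] [ChartedSpace G Y]
  {V : ∀ x : X, Submodule ℂ (TangentSpace 𝓘(ℂ, E) x)}

theorem mem_leafIn_self (U : Set X) (x : X) : x ∈ leafIn V U x :=
  Relation.ReflTransGen.refl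

theorem leafIn_symm {U : Set X} {x y : X} (h : y ∈ leafIn V U x) : x ∈ leafIn V U y := by
  have : Std.Symm (fun a b => ∃ γ : ℂ → X, IsTangentDisc V U γ ∧
      a ∈ γ '' ball 0 1 ∧ b ∈ γ '' ball 0 1) := ⟨fun a b ⟨γ, hγ, ha, hb⟩ => ⟨γ, hγ, hb, ha⟩⟩
  exact Relation.ReflTransGen.stdSymm.symm _ _ h

theorem leafIn_trans {U : Set X} {x y z : X} (hy : y ∈ leafIn V U x) (hz : z ∈ leafIn V U y) :
    z ∈ leafIn V U x :=
  Relation.ReflTransGen.trans hy hz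

theorem leafIn_subset {U : Set X} {x : X} (hx : x ∈ U) : leafIn V U x ⊆ U := by
  intro y hy
  induction hy with
  | refl => exact hx
  | tail _ h _ =>
    obtain ⟨γ, hγ, -, t, ht, rfl⟩ := h
    exact hγ.mapsTo ht

/-- The points of `X` that lie over the subset `B` of the chart at `y₀`. -/
def chartTube (q : X → Y) (y₀ : Y) (B : Set G) : Set X :=
  q ⁻¹' ((chartAt G y₀).source ∩ chartAt G y₀ ⁻¹' B)

theorem isOpen_chartTube {q : X → Y} (hq : Continuous q) (y₀ : Y) {B : Set G} (hB : IsOpen B) :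
    IsOpen (chartTube q y₀ B) :=
  ((chartAt G y₀).isOpen_inter_preimage hB).preimage hq

variable [NormedSpace ℂ G]

theorem IsHorizontalSection.mem_chartTube {q : X → Y} {y₀ : Y} {f : G → X} {B : Set G}
    (h : IsHorizontalSection q V y₀ f B) {y : G} (hy : y ∈ B) : f y ∈ chartTube q y₀ B :=
  ⟨h.mem_source y hy, by rw [mem_preimage, h.apply_eq y hy]; exact hy⟩

/-- A point of the image of a horizontal section is recovered from its projection. -/
theorem IsHorizontalSection.apply_chartAt {q : X → Y} {y₀ : Y} {f : G → X} {B : Set G}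
    (h : IsHorizontalSection q V y₀ f B) {a : X} (ha : a ∈ f '' B) :
    f (chartAt G y₀ (q a)) = a := by
  obtain ⟨y, hy, rfl⟩ := ha
  rw [h.apply_eq y hy]

theorem IsHorizontalSection.continuousAt {q : X → Y} {y₀ : Y} {f : G → X} {B : Set G}
    (hB : IsOpen B) (h : IsHorizontalSection q V y₀ f B) {y : G} (hy : y ∈ B) :
    ContinuousAt f y :=
  h.contMDiffOn.continuousOn.continuousAt (hB.mem_nhds hy)

variable [IsManifold 𝓘(ℂ, G) ω Y]

/-- The image of a horizontal section over a ball is joined to the image of the centre by the discs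
that lie over the complex lines through the centre. -/
theorem IsHorizontalSection.mem_leafIn {q : X → Y} (hq : ContMDiff 𝓘(ℂ, E) 𝓘(ℂ, G) ω q)
    {y₀ : Y} {f : G → X} {c : G} {ε : ℝ} (h : IsHorizontalSection q V y₀ f (ball c ε)) {U : Set X}
    (hU : MapsTo f (ball c ε) U) {y : G} (hy : y ∈ ball c ε) : f y ∈ leafIn V U (f c) := by
  rcases eq_or_ne y c with rfl | hyc
  · exact mem_leafIn_self _ _
  have hd : 0 < ‖y - c‖ := norm_pos_iff.2 (sub_ne_zero.2 hyc)
  have hε : ‖y - c‖ < ε := by rwa [mem_ball, dist_eq_norm] at hy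
  have hε0 : 0 < ε := hd.trans hε
  -- the disc `|t| < 1` covers the part of the line through `c` and `y` in the ball
  let w : G := ((ε / ‖y - c‖ : ℝ) : ℂ) • (y - c)
  have hw : ‖w‖ = ε := by
    simp only [w, norm_smul, Complex.norm_real, Real.norm_of_nonneg (div_pos hε0 hd).le]
    field_simp
  have hw0 : w ≠ 0 := norm_pos_iff.1 (hw ▸ hε0)
  let l : ℂ → G := fun t => c + t • w
  have hl : ∀ t ∈ ball (0 : ℂ) 1, l t ∈ ball c ε := by
    intro t ht
    rw [mem_ball_zero_iff] at ht
    rw [mem_ball, dist_eq_norm, add_sub_cancel_left, norm_smul, hw]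
    nlinarith
  have hld : ∀ t, HasDerivAt l w t := fun t => by
    simpa [l] using! ((hasDerivAt_id t).smul_const w).const_add c
  have hlm : ContMDiff 𝓘(ℂ, ℂ) 𝓘(ℂ, G) ω l := by
    rw [contMDiff_iff_contDiff]
    exact contDiff_const.add (contDiff_id.smul contDiff_const)
  have hv : ∀ t ∈ ball (0 : ℂ) 1, mfderiv 𝓘(ℂ, ℂ) 𝓘(ℂ, E) (fun t => f (l t)) t (1 : ℂ) =
      mfderiv 𝓘(ℂ, G) 𝓘(ℂ, E) f (l t) w := by
    intro t ht
    have h1 := ((h.contMDiffOn.contMDiffAt (isOpen_ball.mem_nhds (hl t ht))).mdifferentiableAt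
      (by simp)).hasMFDerivAt.comp t ((hld t).hasFDerivAt.hasMFDerivAt)
    have h2 := congrArg (fun L => L (1 : ℂ)) h1.mfderiv
    refine h2.trans ?_
    change mfderiv 𝓘(ℂ, G) 𝓘(ℂ, E) f (l t) ((1 : ℂ) • w) = _
    rw [one_smul]
  refine Relation.ReflTransGen.single ⟨fun t => f (l t), ⟨?_, ?_, ?_, ?_⟩, ⟨0, by simp, ?_⟩,
    ⟨((‖y - c‖ / ε : ℝ) : ℂ), ?_, ?_⟩⟩
  · exact h.contMDiffOn.comp hlm.contMDiffOn hl
  · exact fun t ht => hU (hl t ht)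
  · intro t ht h0
    rw [hv t ht] at h0
    exact hw0 (h.mfderiv_injective hq isOpen_ball (hl t ht) (h0.trans (map_zero _).symm))
  · intro t ht
    rw [hv t ht]
    exact h.tangent _ (hl t ht) _
  · simp [l]
  · rw [mem_ball_zero_iff, Complex.norm_real, Real.norm_of_nonneg (by positivity),
      div_lt_one hε0]
    exact hε
  · have : ((‖y - c‖ / ε : ℝ) : ℂ) • w = y - c := by
      simp only [w, smul_smul, ← Complex.ofReal_mul]
      rw [div_mul_div_cancel₀ hε0.ne', div_self hd.ne', Complex.ofReal_one, one_smul]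
    simp only [l, this]
    rw [add_sub_cancel]

variable [IsManifold 𝓘(ℂ, E) ω X] [T2Space X] [CompleteSpace E] [CompleteSpace G]

/-- A chain of tangent discs over `B` that starts on a horizontal section over `B` stays on it. -/
theorem IsHorizontalSection.leafIn_chartTube_subset {q : X → Y}
    (hq : ContMDiff 𝓘(ℂ, E) 𝓘(ℂ, G) ω q)
    (hsub : ∀ x : X, Function.Surjective (mfderiv 𝓘(ℂ, E) 𝓘(ℂ, G) q x))
    (hV : IsIntegrableConnection (F := G) q V) {y₀ : Y} {f : G → X} {B : Set G} (hB : IsOpen B)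
    (h : IsHorizontalSection q V y₀ f B) {a : X} (ha : a ∈ f '' B) :
    leafIn V (chartTube q y₀ B) a ⊆ f '' B := by
  intro b hb
  induction hb with
  | refl => exact ha
  | tail _ hlink ih =>
    obtain ⟨γ, hγ, ⟨t₀, ht₀, rfl⟩, t₁, ht₁, rfl⟩ := hlink
    let c : ℂ → G := fun t => chartAt G y₀ (q (γ t))
    have hcB : ∀ t ∈ ball (0 : ℂ) 1, c t ∈ B := fun t ht => (hγ.mapsTo ht).2
    have hc : ContMDiffOn 𝓘(ℂ, ℂ) 𝓘(ℂ, G) ω c (ball 0 1) :=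
      (contMDiffOn_chart (n := ω) (x := y₀)).comp (hq.comp_contMDiffOn hγ.holomorphic)
        fun t ht => (hγ.mapsTo ht).1
    have hfc : ContMDiffOn 𝓘(ℂ, ℂ) 𝓘(ℂ, E) ω (fun t => f (c t)) (ball 0 1) :=
      h.contMDiffOn.comp hc hcB
    have key := eqOn_of_tangent hq hsub hV isOpen_ball (convex_ball (0 : ℂ) 1).isPreconnected
      hγ.holomorphic hfc hγ.tangent ?_ ?_ ht₀ ?_
    · exact ⟨c t₁, hcB t₁ ht₁, (key ht₁).symm⟩
    · intro t ht
      have h1 := ((h.contMDiffOn.contMDiffAt (hB.mem_nhds (hcB t ht))).mdifferentiableAt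
        (by simp)).hasMFDerivAt.comp t ((hc.contMDiffAt (isOpen_ball.mem_nhds ht)).mdifferentiableAt
          (by simp)).hasMFDerivAt
      have h2 := congrArg (fun L => L (1 : ℂ)) h1.mfderiv
      have h3 : mfderiv 𝓘(ℂ, ℂ) 𝓘(ℂ, E) (fun t => f (c t)) t (1 : ℂ) =
        mfderiv 𝓘(ℂ, G) 𝓘(ℂ, E) f (c t) (mfderiv 𝓘(ℂ, ℂ) 𝓘(ℂ, G) c t (1 : ℂ)) := h2
      rw [h3]
      exact h.tangent _ (hcB t ht) _
    · intro t ht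
      refine (chartAt G y₀).injOn (hγ.mapsTo ht).1 (h.mem_source _ (hcB t ht)) ?_
      rw [h.apply_eq _ (hcB t ht)]
    · exact (h.apply_chartAt ih).symm

/-- **Plaques**: the leaf of the foliation over a ball through a point of a horizontal section is
the image of this section. -/
theorem IsHorizontalSection.leafIn_chartTube_eq {q : X → Y}
    (hq : ContMDiff 𝓘(ℂ, E) 𝓘(ℂ, G) ω q)
    (hsub : ∀ x : X, Function.Surjective (mfderiv 𝓘(ℂ, E) 𝓘(ℂ, G) q x))
    (hV : IsIntegrableConnection (F := G) q V) {y₀ : Y} {f : G → X} {c : G} {ε : ℝ}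
    (h : IsHorizontalSection q V y₀ f (ball c ε)) {a : X} (ha : a ∈ f '' ball c ε) :
    leafIn V (chartTube q y₀ (ball c ε)) a = f '' ball c ε := by
  refine (h.leafIn_chartTube_subset hq hsub hV isOpen_ball ha).antisymm ?_
  rintro _ ⟨y, hy, rfl⟩
  obtain ⟨z, hz, rfl⟩ := ha
  have hm : MapsTo f (ball c ε) (chartTube q y₀ (ball c ε)) := fun w hw => h.mem_chartTube hw
  exact leafIn_trans (leafIn_symm (h.mem_leafIn hq hm hz)) (h.mem_leafIn hq hm hy)

end Plaque

/-! ### The inverse function theorem on complex manifolds -/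

section InverseFunction

open Set Filter Topology

variable {E G : Type*} [NormedAddCommGroup E] [NormedSpace ℂ E] [CompleteSpace E]
  [NormedAddCommGroup G] [NormedSpace ℂ G] [CompleteSpace G]
  {X Y : Type*} [TopologicalSpace X] [ChartedSpace E X] [IsManifold 𝓘(ℂ, E) ω X]
  [TopologicalSpace Y] [ChartedSpace G Y] [IsManifold 𝓘(ℂ, G) ω Y]

/-- A holomorphic map with bijective derivative at a point is a local biholomorphism there. -/
theorem ContMDiff.isLocalDiffeomorphAt_of_bijective {f : X → Y}
    (hf : ContMDiff 𝓘(ℂ, E) 𝓘(ℂ, G) ω f) {x : X}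
    (hx : Function.Bijective (mfderiv 𝓘(ℂ, E) 𝓘(ℂ, G) f x)) :
    IsLocalDiffeomorphAt 𝓘(ℂ, E) 𝓘(ℂ, G) ω f x := by
  set e := chartAt E x with he
  set ψ := chartAt G (f x) with hψ
  have hxe : x ∈ e.source := mem_chart_source E x
  let g : E → G := inCharts f x
  let D : Set E := e.target ∩ e.symm ⁻¹' chartDomain E G f x
  have hD : IsOpen D := e.symm.isOpen_inter_preimage (isOpen_chartDomain hf.continuous x)
  have hxD : e x ∈ D := ⟨e.map_source hxe, by
    rw [mem_preimage, e.left_inv hxe]; exact mem_chartDomain f x⟩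
  have hg : ContDiffOn ℂ ω g D := contDiffOn_inCharts hf x
  have hgx : ContDiffAt ℂ ω g (e x) := hg.contDiffAt (hD.mem_nhds hxD)
  have hbe := mfderiv_chartAt_bijective (E := E) hxe
  have hbψ := mfderiv_chartAt_bijective (E := G) (mem_chart_source G (f x))
  have hcomp : ∀ v, fderiv ℂ g (e x) (mfderiv 𝓘(ℂ, E) 𝓘(ℂ, E) e x v) = _ :=
    fderiv_inCharts_mfderiv_chartAt hf (mem_chartDomain f x)
  have hbg : Function.Bijective (fderiv ℂ g (e x)) := by
    have h1 : Function.Bijective (fun v => fderiv ℂ g (e x) (mfderiv 𝓘(ℂ, E) 𝓘(ℂ, E) e x v)) := by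
      rw [funext hcomp]
      exact hbψ.comp hx
    exact (Function.Bijective.of_comp_iff (fderiv ℂ g (e x)) hbe).1 h1
  let L : E ≃L[ℂ] G := ContinuousLinearEquiv.ofBijective (fderiv ℂ g (e x))
    (LinearMap.ker_eq_bot.2 hbg.1) (LinearMap.range_eq_top.2 hbg.2)
  have hL : HasFDerivAt g (L : E →L[ℂ] G) (e x) := (hgx.differentiableAt (by simp)).hasFDerivAt
  let Φ : OpenPartialHomeomorph E G := hgx.toOpenPartialHomeomorph g hL (by simp)
  have hΦx : e x ∈ Φ.source := hgx.mem_toOpenPartialHomeomorph_source hL (by simp)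
  have hΦs : ContDiffAt ℂ ω Φ.symm (Φ (e x)) :=
    Φ.contDiffAt_symm (Φ.map_source hΦx) (f₀' := L)
      (by rw [Φ.left_inv hΦx]; exact hL) (by rw [Φ.left_inv hΦx]; exact hgx)
  -- shrink `Φ` to a neighbourhood on which it and its inverse are analytic
  obtain ⟨T, hTs, hTo, hxT⟩ := mem_nhds_iff.1 (hΦs.eventually (by simp))
  let W : Set E := D ∩ (Φ.source ∩ Φ ⁻¹' T)
  have hW : IsOpen W := hD.inter (Φ.isOpen_inter_preimage hTo)
  let Ψ := Φ.restrOpen W hW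
  have hΨs : Ψ.source = Φ.source ∩ W := Φ.restrOpen_source W hW
  let χ : OpenPartialHomeomorph X Y := (e.trans Ψ).trans ψ.symm
  have hχ : ∀ z ∈ χ.source, z ∈ e.source ∧ e z ∈ W ∧ g (e z) ∈ ψ.target := by
    intro z hz
    have h1 : (z ∈ e.source ∧ e z ∈ Ψ.source) ∧ Ψ (e z) ∈ ψ.target := by
      simpa [χ, OpenPartialHomeomorph.trans_source] using hz
    rw [hΨs] at h1
    exact ⟨h1.1.1, h1.1.2.2, h1.2⟩
  have hχt : ∀ y ∈ χ.target, y ∈ ψ.source ∧ ψ y ∈ T ∧ Φ.symm (ψ y) ∈ D := by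
    intro y hy
    have h1 : y ∈ ψ.source ∧ ψ y ∈ Ψ.target ∧ Ψ.symm (ψ y) ∈ e.target := by
      have := hy
      simp only [χ, OpenPartialHomeomorph.trans_target, OpenPartialHomeomorph.symm_target,
        mem_inter_iff, mem_preimage, OpenPartialHomeomorph.symm_symm] at this
      exact this
    have h2 : Φ.symm (ψ y) ∈ Φ.source ∩ W := by
      have := Ψ.map_target h1.2.1
      rwa [hΨs] at this
    have h3 : ψ y ∈ Φ.target := by
      have h4 : Ψ (Ψ.symm (ψ y)) = ψ y := Ψ.right_inv h1.2.1
      rw [← h4]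
      exact Φ.map_source h2.1
    refine ⟨h1.1, ?_, h2.2.1⟩
    have h5 := h2.2.2.2
    rwa [mem_preimage, Φ.right_inv h3] at h5
  refine ⟨{ toPartialEquiv := χ.toPartialEquiv
            open_source := χ.open_source
            open_target := χ.open_target
            contMDiffOn_toFun := ?_
            contMDiffOn_invFun := ?_ }, ?_, ?_⟩
  · have h1 : ContMDiffOn 𝓘(ℂ, E) 𝓘(ℂ, G) ω (fun z => ψ.symm (g (e z))) χ.source :=
      (contMDiffOn_chart_symm (n := ω)).comp (hg.contMDiffOn.comp
        ((contMDiffOn_chart (n := ω)).mono fun z hz => (hχ z hz).1)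
        fun z hz => (hχ z hz).2.1.1) fun z hz => (hχ z hz).2.2
    exact h1
  · have h1 : ContDiffOn ℂ ω Φ.symm T := fun y hy =>
      (show ContDiffAt ℂ ω Φ.symm y from hTs hy).contDiffWithinAt
    have h2 : ContMDiffOn 𝓘(ℂ, G) 𝓘(ℂ, E) ω (fun y => e.symm (Φ.symm (ψ y))) χ.target :=
      (contMDiffOn_chart_symm (n := ω)).comp (h1.contMDiffOn.comp
        ((contMDiffOn_chart (n := ω)).mono fun y hy => (hχt y hy).1)
        fun y hy => (hχt y hy).2.1) fun y hy => (hχt y hy).2.2.1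
    exact h2
  · change x ∈ χ.source
    have h1 : (x ∈ e.source ∧ e x ∈ Ψ.source) ∧ Ψ (e x) ∈ ψ.target := by
      rw [hΨs]
      refine ⟨⟨hxe, hΦx, hxD, hΦx, hxT⟩, ?_⟩
      change ψ (f (e.symm (e x))) ∈ ψ.target
      rw [e.left_inv hxe]
      exact ψ.map_source (mem_chart_source G (f x))
    simpa [χ, OpenPartialHomeomorph.trans_source] using h1
  · intro z hz
    have h1 := hχ z hz
    have h2 := h1.2.1.1.2
    rw [mem_preimage, e.left_inv h1.1] at h2
    change f z = ψ.symm (ψ (f (e.symm (e z))))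
    rw [e.left_inv h1.1, ψ.left_inv h2.2]

end InverseFunction

/-! ### The leaf topology and the complex structure of the leaves -/

section LeafTopology

open Set Filter Topology Metric

variable {E G : Type*} [NormedAddCommGroup E] [NormedSpace ℂ E]
  [NormedAddCommGroup G] [NormedSpace ℂ G]
  {X Y : Type*} [TopologicalSpace X] [ChartedSpace E X]
  [TopologicalSpace Y] [ChartedSpace G Y]
  {V : ∀ x : X, Submodule ℂ (TangentSpace 𝓘(ℂ, E) x)}

theorem Leaf.pt_injective (x : X) : Function.Injective (Leaf.pt : Leaf V x → X) := by
  rintro ⟨a, ha⟩ ⟨b, hb⟩ h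
  cases h
  rfl

theorem isOpen_setOf_mem_leafIn (x : X) {U : Set X} (hU : IsOpen U) {y : X} (hy : y ∈ U) :
    IsOpen {p : Leaf V x | p.pt ∈ leafIn V U y} :=
  TopologicalSpace.isOpen_generateFrom_of_mem ⟨U, y, hU, hy, rfl⟩

theorem Leaf.continuous_pt (x : X) : Continuous (Leaf.pt : Leaf V x → X) := by
  refine continuous_def.2 fun U hU => isOpen_iff_forall_mem_open.2 fun p hp => ?_
  exact ⟨{r | r.pt ∈ leafIn V U p.pt}, fun r hr => leafIn_subset (V := V) hp hr,
    isOpen_setOf_mem_leafIn x hU hp, mem_leafIn_self U p.pt⟩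

variable [IsManifold 𝓘(ℂ, G) ω Y]

theorem IsHorizontalSection.mem_leaf {q : X → Y} (hq : ContMDiff 𝓘(ℂ, E) 𝓘(ℂ, G) ω q)
    {y₀ : Y} {f : G → X} {c : G} {ε : ℝ} (h : IsHorizontalSection q V y₀ f (ball c ε)) {x : X}
    (p : Leaf V x) (hp : p.pt ∈ f '' ball c ε) {y : G} (hy : y ∈ ball c ε) : f y ∈ leaf V x := by
  obtain ⟨z, hz, hzp⟩ := hp
  have h1 := h.mem_leafIn hq (mapsTo_univ _ _) hz
  rw [hzp] at h1
  exact leafIn_trans (leafIn_trans p.mem (leafIn_symm h1)) (h.mem_leafIn hq (mapsTo_univ _ _) hy)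

/-- For every leaf atlas, `q` restricts to a local biholomorphism on the leaf: its derivative is
the restriction of `dq` to `V`. -/
theorem IsLeafAtlas.isLocalDiffeomorph {q : X → Y} (hq : ContMDiff 𝓘(ℂ, E) 𝓘(ℂ, G) ω q)
    (hsub : ∀ x : X, Function.Surjective (mfderiv 𝓘(ℂ, E) 𝓘(ℂ, G) q x))
    (hcompl : ∀ x : X, IsCompl (V x) (mfderiv 𝓘(ℂ, E) 𝓘(ℂ, G) q x).ker) [CompleteSpace G] {x : X}
    [ChartedSpace G (Leaf V x)] (h : IsLeafAtlas (F := G) V x) :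
    IsLocalDiffeomorph 𝓘(ℂ, G) 𝓘(ℂ, G) ω fun p : Leaf V x => q p.pt := by
  have := h.isManifold
  intro p
  have hd : ∀ v, mfderiv 𝓘(ℂ, G) 𝓘(ℂ, G) (fun p : Leaf V x => q p.pt) p v =
      mfderiv 𝓘(ℂ, E) 𝓘(ℂ, G) q p.pt
        (mfderiv 𝓘(ℂ, G) 𝓘(ℂ, E) (Leaf.pt : Leaf V x → X) p v) := fun v =>
    congrArg (fun L => L v) ((hq.mdifferentiableAt (by simp)).hasMFDerivAt.comp p
      (h.holomorphic.mdifferentiableAt (by simp)).hasMFDerivAt).mfderiv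
  refine ContMDiff.isLocalDiffeomorphAt_of_bijective (hq.comp h.holomorphic) ⟨?_, ?_⟩
  · intro v w hvw
    have h1 := (hd v).symm.trans (hvw.trans (hd w))
    have hmem : ∀ u, mfderiv 𝓘(ℂ, G) 𝓘(ℂ, E) (Leaf.pt : Leaf V x → X) p u ∈ V p.pt := fun u => by
      rw [← h.tangent p]
      exact ⟨u, rfl⟩
    refine h.immersion p (sub_eq_zero.1 (Submodule.disjoint_def.1 (hcompl p.pt).disjoint _
      ((V p.pt).sub_mem (hmem v) (hmem w)) ?_))
    change mfderiv 𝓘(ℂ, E) 𝓘(ℂ, G) q p.pt (_ - _) = 0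
    rw [map_sub, h1, sub_self]
  · intro u
    obtain ⟨z, hz⟩ := hsub p.pt u
    obtain ⟨v, hv, n, hn, hvn⟩ :=
      Submodule.mem_sup.1 ((hcompl p.pt).sup_eq_top ▸ Submodule.mem_top (x := z))
    rw [← h.tangent p] at hv
    obtain ⟨v', rfl⟩ := hv
    refine ⟨v', (hd v').trans ?_⟩
    rw [← hz, ← hvn, map_add, show mfderiv 𝓘(ℂ, E) 𝓘(ℂ, G) q p.pt n = 0 from hn, add_zero]
    rfl

variable [IsManifold 𝓘(ℂ, E) ω X] [CompleteSpace E] [CompleteSpace G]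

/-- A horizontal section through a point `p` of a leaf, given over a ball around the point of the
model space `G` that corresponds to `q p`. -/
theorem Leaf.exists_mem_horizontalSection {q : X → Y} (hq : ContMDiff 𝓘(ℂ, E) 𝓘(ℂ, G) ω q)
    (hsub : ∀ x : X, Function.Surjective (mfderiv 𝓘(ℂ, E) 𝓘(ℂ, G) q x))
    (hV : IsIntegrableConnection (F := G) q V) {x : X} (p : Leaf V x) :
    ∃ (ε : ℝ) (f : G → X), IsHorizontalSection q V (q p.pt) f
      (ball (chartAt G (q p.pt) (q p.pt)) ε) ∧
      p.pt ∈ f '' ball (chartAt G (q p.pt) (q p.pt)) ε := by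
  obtain ⟨ε, hε, h⟩ := exists_isHorizontalSection hq hsub hV p.pt
  obtain ⟨f, hf0, hf⟩ := h.self_of_nhds
  exact ⟨ε, f, hf, _, mem_ball_self hε, hf0⟩

variable [T2Space X]

/-- The part of a leaf in a plaque is open: a plaque is a leaf of the foliation over a ball. -/
theorem IsHorizontalSection.isOpen_plaque {q : X → Y}
    (hq : ContMDiff 𝓘(ℂ, E) 𝓘(ℂ, G) ω q)
    (hsub : ∀ x : X, Function.Surjective (mfderiv 𝓘(ℂ, E) 𝓘(ℂ, G) q x))
    (hV : IsIntegrableConnection (F := G) q V) {y₀ : Y} {f : G → X} {c : G} {ε : ℝ}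
    (h : IsHorizontalSection q V y₀ f (ball c ε)) (x : X) :
    IsOpen {p : Leaf V x | p.pt ∈ f '' ball c ε} := by
  rcases le_or_gt ε 0 with hε | hε
  · simp [ball_eq_empty.2 hε]
  have hc : f c ∈ f '' ball c ε := ⟨c, mem_ball_self hε, rfl⟩
  rw [← h.leafIn_chartTube_eq hq hsub hV hc]
  exact isOpen_setOf_mem_leafIn x (isOpen_chartTube hq.continuous y₀ isOpen_ball)
    (h.mem_chartTube (mem_ball_self hε))

open Classical in
/-- The chart of a leaf given by a plaque: it is the projection `q`, in the chart of `Y` at `y₀`,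
and its inverse is the horizontal section. -/
noncomputable def IsHorizontalSection.plaqueChart {q : X → Y}
    (hq : ContMDiff 𝓘(ℂ, E) 𝓘(ℂ, G) ω q)
    (hsub : ∀ x : X, Function.Surjective (mfderiv 𝓘(ℂ, E) 𝓘(ℂ, G) q x))
    (hV : IsIntegrableConnection (F := G) q V) {y₀ : Y} {f : G → X} {c : G} {ε : ℝ}
    (h : IsHorizontalSection q V y₀ f (ball c ε)) {x : X} (p : Leaf V x)
    (hp : p.pt ∈ f '' ball c ε) : OpenPartialHomeomorph (Leaf V x) G where
  toFun r := chartAt G y₀ (q r.pt)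
  invFun y := if hy : f y ∈ leaf V x then ⟨f y, hy⟩ else p
  source := {r | r.pt ∈ f '' ball c ε}
  target := ball c ε
  map_source' r hr := by
    obtain ⟨y, hy, hyr⟩ := hr
    rw [← hyr, h.apply_eq y hy]
    exact hy
  map_target' y hy := by
    rw [dif_pos (h.mem_leaf hq p hp hy)]
    exact ⟨y, hy, rfl⟩
  left_inv' r hr := by
    apply Leaf.pt_injective
    have h1 : f (chartAt G y₀ (q r.pt)) = r.pt := h.apply_chartAt hr
    rw [dif_pos (by rw [h1]; exact r.mem)]
    exact h1
  right_inv' y hy := by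
    rw [dif_pos (h.mem_leaf hq p hp hy)]
    exact h.apply_eq y hy
  open_source := h.isOpen_plaque hq hsub hV x
  open_target := isOpen_ball
  continuousOn_toFun := by
    refine (chartAt G y₀).continuousOn.comp
      (hq.continuous.comp (Leaf.continuous_pt x)).continuousOn ?_
    rintro r ⟨y, hy, hyr⟩
    change q r.pt ∈ _
    rw [← hyr]
    exact h.mem_source y hy
  continuousOn_invFun := by
    intro y hy
    refine ContinuousAt.continuousWithinAt (TopologicalSpace.tendsto_nhds_generateFrom_iff.2 ?_)
    rintro _ ⟨U, z, hU, hz, rfl⟩ hyU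
    have hpt : ∀ w ∈ ball c ε,
        (if hw : f w ∈ leaf V x then (⟨f w, hw⟩ : Leaf V x) else p).pt = f w := fun w hw => by
      rw [dif_pos (h.mem_leaf hq p hp hw)]
    have hyU : f y ∈ leafIn V U z := by
      rw [← hpt y hy]
      exact hyU
    have h1 : ∀ᶠ y' in 𝓝 y, f y' ∈ U ∧ y' ∈ ball c ε :=
      ((h.continuousAt isOpen_ball hy).eventually_mem (hU.mem_nhds (leafIn_subset hz hyU))).and
        (isOpen_ball.mem_nhds hy)
    obtain ⟨δ, hδ, hδ'⟩ := Metric.eventually_nhds_iff_ball.1 h1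
    filter_upwards [ball_mem_nhds y hδ] with y' hy'
    change (dite (f y' ∈ leaf V x) _ _ : Leaf V x).pt ∈ leafIn V U z
    rw [hpt y' (hδ' y' hy').2]
    exact leafIn_trans hyU ((h.mono fun w hw => (hδ' w hw).2).mem_leafIn hq
      (fun w hw => (hδ' w hw).1) hy')

theorem IsHorizontalSection.plaqueChart_symm_pt {q : X → Y}
    (hq : ContMDiff 𝓘(ℂ, E) 𝓘(ℂ, G) ω q)
    (hsub : ∀ x : X, Function.Surjective (mfderiv 𝓘(ℂ, E) 𝓘(ℂ, G) q x))
    (hV : IsIntegrableConnection (F := G) q V) {y₀ : Y} {f : G → X} {c : G} {ε : ℝ}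
    (h : IsHorizontalSection q V y₀ f (ball c ε)) {x : X} (p : Leaf V x)
    (hp : p.pt ∈ f '' ball c ε) {y : G} (hy : y ∈ ball c ε) :
    ((h.plaqueChart hq hsub hV p hp).symm y).pt = f y := by
  classical
  change (dite (f y ∈ leaf V x) _ _ : Leaf V x).pt = f y
  rw [dif_pos (h.mem_leaf hq p hp hy)]

/-- The complex structure of a leaf, whose charts are the plaque charts. -/
@[reducible]
noncomputable def Leaf.chartedSpace {q : X → Y} (hq : ContMDiff 𝓘(ℂ, E) 𝓘(ℂ, G) ω q)
    (hsub : ∀ x : X, Function.Surjective (mfderiv 𝓘(ℂ, E) 𝓘(ℂ, G) q x))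
    (hV : IsIntegrableConnection (F := G) q V) (x : X) : ChartedSpace G (Leaf V x) :=
  let chart : Leaf V x → OpenPartialHomeomorph (Leaf V x) G := fun p =>
    let h := (Leaf.exists_mem_horizontalSection hq hsub hV p).choose_spec.choose_spec
    h.1.plaqueChart hq hsub hV p h.2
  { atlas := range chart
    chartAt := chart
    mem_chart_source := fun p =>
      (Leaf.exists_mem_horizontalSection hq hsub hV p).choose_spec.choose_spec.2
    chart_mem_atlas := fun p => ⟨p, rfl⟩ }

/-- The plaque charts make the leaf an immersed complex submanifold with tangent spaces `V`: near
a point, the inclusion into `X` is a chart followed by a horizontal section. -/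
theorem Leaf.exists_isLeafAtlas {q : X → Y} (hq : ContMDiff 𝓘(ℂ, E) 𝓘(ℂ, G) ω q)
    (hsub : ∀ x : X, Function.Surjective (mfderiv 𝓘(ℂ, E) 𝓘(ℂ, G) q x))
    (hV : IsIntegrableConnection (F := G) q V) (x : X) :
    ∃ _ : ChartedSpace G (Leaf V x), IsLeafAtlas (F := G) V x := by
  let _ := Leaf.chartedSpace hq hsub hV x
  have hchart : ∀ p : Leaf V x, ∃ (y₀ : Y) (f : G → X) (c : G) (ε : ℝ)
      (h : IsHorizontalSection q V y₀ f (ball c ε)) (hp : p.pt ∈ f '' ball c ε),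
      chartAt G p = h.plaqueChart hq hsub hV p hp := fun p =>
    ⟨_, _, _, _, (Leaf.exists_mem_horizontalSection hq hsub hV p).choose_spec.choose_spec.1,
      (Leaf.exists_mem_horizontalSection hq hsub hV p).choose_spec.choose_spec.2, rfl⟩
  have hman : IsManifold 𝓘(ℂ, G) ω (Leaf V x) := by
    refine isManifold_of_contDiffOn 𝓘(ℂ, G) ω (Leaf V x) ?_
    intro e e' he he'
    obtain ⟨p, rfl⟩ : ∃ p, chartAt G p = e := he
    obtain ⟨r, rfl⟩ : ∃ r, chartAt G r = e' := he'
    obtain ⟨y₀, f, c, ε, h, hp, hpe⟩ := hchart p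
    obtain ⟨y₁, g, d, δ, h', hr, hre⟩ := hchart r
    rw [hpe, hre]
    have hmem : ∀ y ∈ 𝓘(ℂ, G).symm ⁻¹' ((h.plaqueChart hq hsub hV p hp).symm.trans
        (h'.plaqueChart hq hsub hV r hr)).source ∩ range 𝓘(ℂ, G),
        y ∈ ball c ε ∧ f y ∈ g '' ball d δ := by
      rintro y ⟨hy, -⟩
      have h1 : y ∈ ball c ε ∧ (((h.plaqueChart hq hsub hV p hp).symm y).pt ∈ g '' ball d δ) := by
        simpa using! hy
      refine ⟨h1.1, ?_⟩
      rw [← h.plaqueChart_symm_pt hq hsub hV p hp h1.1]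
      exact h1.2
    have h1 : ContMDiffOn 𝓘(ℂ, G) 𝓘(ℂ, G) ω (fun y => chartAt G y₁ (q (f y)))
        (𝓘(ℂ, G).symm ⁻¹' ((h.plaqueChart hq hsub hV p hp).symm.trans
        (h'.plaqueChart hq hsub hV r hr)).source ∩ range 𝓘(ℂ, G)) := by
      refine (contMDiffOn_chart (n := ω)).comp
        (hq.comp_contMDiffOn (h.contMDiffOn.mono fun y hy => (hmem y hy).1)) fun y hy => ?_
      obtain ⟨z, hz, hzy⟩ := (hmem y hy).2
      rw [mem_preimage, ← hzy]
      exact h'.mem_source z hz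
    refine (contMDiffOn_iff_contDiffOn.1 h1).congr fun y hy => ?_
    change chartAt G y₁ (q ((h.plaqueChart hq hsub hV p hp).symm y).pt) = _
    rw [h.plaqueChart_symm_pt hq hsub hV p hp (hmem y hy).1]
  -- near `p`, the inclusion is the horizontal section composed with the chart
  have hpt : ∀ p : Leaf V x, ∃ (y₀ : Y) (f : G → X) (B : Set G), IsOpen B ∧
      IsHorizontalSection q V y₀ f B ∧ chartAt G p p ∈ B ∧ f (chartAt G p p) = p.pt ∧
      (Leaf.pt : Leaf V x → X) =ᶠ[𝓝 p] f ∘ chartAt G p := by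
    intro p
    obtain ⟨y₀, f, c, ε, h, hp, hpe⟩ := hchart p
    refine ⟨y₀, f, ball c ε, isOpen_ball, h, ?_, ?_, ?_⟩
    · rw [hpe]
      exact (h.plaqueChart hq hsub hV p hp).map_source hp
    · rw [hpe]
      exact h.apply_chartAt hp
    · rw [hpe]
      filter_upwards [(h.plaqueChart hq hsub hV p hp).open_source.mem_nhds hp] with r hr
      exact (h.apply_chartAt hr).symm
  have hsmooth : ∀ p : Leaf V x, ContMDiffAt 𝓘(ℂ, G) 𝓘(ℂ, G) ω (chartAt G p) p := fun p =>
    (contMDiffOn_chart (n := ω)).contMDiffAt ((chartAt G p).open_source.mem_nhds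
      (mem_chart_source G p))
  have hderiv : ∀ p : Leaf V x, ∃ (y₀ : Y) (f : G → X) (B : Set G), IsOpen B ∧
      IsHorizontalSection q V y₀ f B ∧ chartAt G p p ∈ B ∧ f (chartAt G p p) = p.pt ∧
      ∀ v, mfderiv 𝓘(ℂ, G) 𝓘(ℂ, E) (Leaf.pt : Leaf V x → X) p v =
        (mfderiv 𝓘(ℂ, G) 𝓘(ℂ, E) f (chartAt G p p)
          (mfderiv 𝓘(ℂ, G) 𝓘(ℂ, G) (chartAt G p) p v) : E) := by
    intro p
    obtain ⟨y₀, f, B, hB, h, hpB, hfp, hev⟩ := hpt p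
    refine ⟨y₀, f, B, hB, h, hpB, hfp, fun v => ?_⟩
    have h1 := (((h.contMDiffOn.contMDiffAt (hB.mem_nhds hpB)).mdifferentiableAt
      (by simp)).hasMFDerivAt.comp p ((hsmooth p).mdifferentiableAt (by simp)).hasMFDerivAt)
    exact congrArg (fun L => L v) (h1.congr_of_eventuallyEq hev).mfderiv
  refine ⟨inferInstance, hman, ?_, ?_, ?_⟩
  · intro p
    obtain ⟨y₀, f, B, hB, h, hpB, hfp, hev⟩ := hpt p
    exact ((h.contMDiffOn.contMDiffAt (hB.mem_nhds hpB)).comp p (hsmooth p)).congr_of_eventuallyEq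
      hev
  · intro p v w hvw
    obtain ⟨y₀, f, B, hB, h, hpB, hfp, hd⟩ := hderiv p
    have h1 := (hd v).symm.trans (hvw.trans (hd w))
    exact (mfderiv_chartAt_bijective (mem_chart_source G p)).1
      (h.mfderiv_injective hq hB hpB h1)
  · intro p
    obtain ⟨y₀, f, B, hB, h, hpB, hfp, hd⟩ := hderiv p
    have hr := h.range_mfderiv hq hV.isCompl hB hpB
    rw [← hfp, ← hr]
    ext v
    constructor
    · rintro ⟨u, rfl⟩
      exact ⟨_, (hd u).symm⟩
    · rintro ⟨u, rfl⟩
      obtain ⟨u', rfl⟩ := (mfderiv_chartAt_bijective (mem_chart_source G p)).2 u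
      exact ⟨u', hd u'⟩

end LeafTopology

/-! ### Leaves as covering spaces -/

section Covering

open Set Filter Topology Metric

variable {E G : Type*} [NormedAddCommGroup E] [NormedSpace ℂ E] [CompleteSpace E]
  [NormedAddCommGroup G] [NormedSpace ℂ G] [CompleteSpace G]
  {X Y : Type*} [TopologicalSpace X] [ChartedSpace E X] [IsManifold 𝓘(ℂ, E) ω X]
  [TopologicalSpace Y] [ChartedSpace G Y] [IsManifold 𝓘(ℂ, G) ω Y]
  {V : ∀ x : X, Submodule ℂ (TangentSpace 𝓘(ℂ, E) x)}

/-- Over a compact part of a fibre of `q` the radii of the balls that carry horizontal sections are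
bounded below. -/
theorem IsCompact.exists_isHorizontalSection {q : X → Y} (hq : ContMDiff 𝓘(ℂ, E) 𝓘(ℂ, G) ω q)
    (hsub : ∀ x : X, Function.Surjective (mfderiv 𝓘(ℂ, E) 𝓘(ℂ, G) q x))
    (hV : IsIntegrableConnection (F := G) q V) {K : Set X} (hK : IsCompact K) {y : Y}
    (hKy : ∀ x ∈ K, q x = y) :
    ∃ ε > 0, ∀ᶠ a in 𝓝ˢ K, ∃ f : G → X, f (chartAt G y (q a)) = a ∧
      IsHorizontalSection q V y f (ball (chartAt G y (q a)) ε) := by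
  refine hK.induction_on (p := fun s => ∃ ε > 0, ∀ᶠ a in 𝓝ˢ s, ∃ f : G → X,
    f (chartAt G y (q a)) = a ∧ IsHorizontalSection q V y f (ball (chartAt G y (q a)) ε))
    ⟨1, one_pos, by simp⟩ ?_ ?_ ?_
  · rintro s t hst ⟨ε, hε, h⟩
    exact ⟨ε, hε, h.filter_mono (nhdsSet_mono hst)⟩
  · rintro s t ⟨ε, hε, h⟩ ⟨δ, hδ, h'⟩
    refine ⟨min ε δ, lt_min hε hδ, ?_⟩
    rw [nhdsSet_union, eventually_sup]
    constructor
    · filter_upwards [h] with a ⟨f, hfa, hf⟩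
      exact ⟨f, hfa, hf.mono (ball_subset_ball (min_le_left _ _))⟩
    · filter_upwards [h'] with a ⟨f, hfa, hf⟩
      exact ⟨f, hfa, hf.mono (ball_subset_ball (min_le_right _ _))⟩
  · intro x hx
    obtain ⟨ε, hε, h⟩ := _root_.exists_isHorizontalSection hq hsub hV x
    rw [hKy x hx] at h
    exact ⟨_, mem_nhdsWithin_of_mem_nhds (eventually_eventually_nhds.2 h), ε, hε,
      eventually_nhdsSet_iff_forall.2 fun z hz => hz⟩

variable [T2Space X]

/-- If horizontal sections over balls of a fixed radius `ε` pass through the points of a leaf that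
lie over a neighbourhood of `y`, then this leaf is evenly covered by `q` at `y`: over a ball of
radius at most `ε / 2`, it is the disjoint union of the plaques through the points over `y`. -/
theorem Leaf.isEvenlyCovered {q : X → Y} (hq : ContMDiff 𝓘(ℂ, E) 𝓘(ℂ, G) ω q)
    (hsub : ∀ x : X, Function.Surjective (mfderiv 𝓘(ℂ, E) 𝓘(ℂ, G) q x))
    (hV : IsIntegrableConnection (F := G) q V) {x : X} {y : Y} {ε : ℝ} (hε : 0 < ε)
    (hsec : ∀ᶠ z in 𝓝 y, ∀ p : Leaf V x, q p.pt = z → ∃ f : G → X, f (chartAt G y z) = p.pt ∧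
      IsHorizontalSection q V y f (ball (chartAt G y z) ε))
    (hne : ∃ p : Leaf V x, q p.pt = y) :
    IsEvenlyCovered (fun p : Leaf V x => q p.pt) y
      ((fun p : Leaf V x => q p.pt) ⁻¹' {y}) := by
  set ψ := chartAt G y with hψ
  have hy : y ∈ ψ.source := mem_chart_source G y
  have hcont : Continuous fun p : Leaf V x => q p.pt := hq.continuous.comp (Leaf.continuous_pt x)
  obtain ⟨δ', hδ', hball⟩ : ∃ δ > 0, ∀ u ∈ ball (ψ y) δ, ∀ p : Leaf V x, q p.pt = ψ.symm u →
      ∃ f : G → X, f (ψ (ψ.symm u)) = p.pt ∧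
        IsHorizontalSection q V y f (ball (ψ (ψ.symm u)) ε) := by
    have h1 : Tendsto ψ.symm (𝓝 (ψ y)) (𝓝 y) := by
      simpa [ψ.left_inv hy] using (ψ.continuousAt_symm (ψ.map_source hy)).tendsto
    exact Metric.eventually_nhds_iff_ball.1 (h1.eventually hsec)
  obtain ⟨δ, hδ, hδε, hδδ'⟩ : ∃ δ > 0, δ ≤ ε / 2 ∧ δ ≤ δ' :=
    ⟨min (ε / 2) δ', lt_min (by positivity) hδ', min_le_left _ _, min_le_right _ _⟩
  let B : Set G := ball (ψ y) δ
  let N : Set Y := ψ.source ∩ ψ ⁻¹' B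
  have hyN : y ∈ N := ⟨hy, mem_ball_self hδ⟩
  -- the section over `B` through a given point of the leaf over `N`
  have hsecB : ∀ p : Leaf V x, q p.pt ∈ N → ∃ f : G → X, IsHorizontalSection q V y f B ∧
      p.pt ∈ f '' B := by
    rintro p ⟨hp, hpB⟩
    obtain ⟨f, hf, hsf⟩ := hball _ (ball_subset_ball hδδ' hpB) p (ψ.left_inv hp).symm
    rw [ψ.left_inv hp] at hf hsf
    refine ⟨f, hsf.mono ?_, _, hpB, hf⟩
    intro u hu
    have h1 : dist (ψ (q p.pt)) (ψ y) < δ := hpB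
    have h2 : dist u (ψ y) < δ := hu
    rw [mem_ball]
    linarith [dist_triangle_right u (ψ (q p.pt)) (ψ y)]
  let ι := (fun p : Leaf V x => q p.pt) ⁻¹' {y}
  have hιN : ∀ i : ι, q i.1.pt ∈ N := fun i => by
    rw [show q i.1.pt = y from i.2]
    exact hyN
  choose f hf hfi using fun i : ι => hsecB i.1 (hιN i)
  have hfy : ∀ i : ι, f i (ψ y) = i.1.pt := fun i => by
    have h1 := (hf i).apply_chartAt (hfi i)
    rwa [show q i.1.pt = y from i.2] at h1
  let U : ι → Set (Leaf V x) := fun i => {r | r.pt ∈ f i '' B}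
  -- a plaque is determined by any of its points
  have hplaque : ∀ (g : G → X) (i : ι) (a : X), IsHorizontalSection q V y g B → a ∈ g '' B →
      a ∈ f i '' B → g '' B = f i '' B := fun g i a hg ha ha' => by
    rw [← hg.leafIn_chartTube_eq hq hsub hV ha, (hf i).leafIn_chartTube_eq hq hsub hV ha']
  have hUN : ∀ i, ∀ r ∈ U i, q r.pt ∈ ψ.source ∧ ψ (q r.pt) ∈ B ∧ f i (ψ (q r.pt)) = r.pt := by
    rintro i r ⟨u, hu, hur⟩
    rw [← hur]
    refine ⟨(hf i).mem_source u hu, ?_, ?_⟩ <;> rw [(hf i).apply_eq u hu]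
    exact hu
  have hlift : ∀ i, ∀ z ∈ N, ∃ r ∈ U i, q r.pt = z := by
    intro i z hz
    refine ⟨⟨f i (ψ z), (hf i).mem_leaf hq i.1 (hfi i) hz.2⟩, ⟨_, hz.2, rfl⟩, ?_⟩
    exact ψ.injOn ((hf i).mem_source _ hz.2) hz.1 ((hf i).apply_eq _ hz.2)
  let _ : TopologicalSpace ι := ⊥
  have : DiscreteTopology ι := ⟨rfl⟩
  have : Nonempty ι := let ⟨p, hp⟩ := hne; ⟨⟨p, hp⟩⟩
  have : Nonempty (Y → Leaf V x) := let ⟨p, hp⟩ := hne; ⟨fun _ => p⟩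
  refine (IsEvenlyCovered.of_trivialization (I := ι)
    (t := IsOpen.trivializationDiscrete (f := fun p : Leaf V x => q p.pt) U N
      (ψ.isOpen_inter_preimage isOpen_ball) ?_ ?_ ?_ ?_ ?_) hyN).to_isEvenlyCovered_preimage
  · intro i W hW
    refine ⟨fun h => (h.preimage hcont).inter ((hf i).isOpen_plaque hq hsub hV x), fun h => ?_⟩
    let Φ := (hf i).plaqueChart hq hsub hV i.1 (hfi i)
    have h1 : IsOpen (Φ '' ((fun p : Leaf V x => q p.pt) ⁻¹' W ∩ U i)) :=
      Φ.isOpen_image_of_subset_source h inter_subset_right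
    convert ψ.isOpen_inter_preimage h1 using 1
    ext z
    constructor
    · intro hz
      obtain ⟨r, hr, rfl⟩ := hlift i z (hW hz)
      exact ⟨(hW hz).1, r, ⟨hz, hr⟩, rfl⟩
    · rintro ⟨hz, r, ⟨hrW, hr⟩, hrz⟩
      rw [← ψ.injOn (hUN i r hr).1 hz hrz]
      exact hrW
  · intro i r hr s hs hrs
    refine Leaf.pt_injective x ?_
    rw [← (hUN i r hr).2.2, ← (hUN i s hs).2.2]
    exact congrArg (fun z => f i (ψ z)) hrs
  · exact fun i z hz => hlift i z hz
  · intro i j hij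
    refine disjoint_left.2 fun r hr hr' => hij ?_
    have h1 := hplaque (f i) j r.pt (hf i) hr hr'
    have h2 : i.1.pt ∈ f j '' B := h1 ▸ hfi i
    refine Subtype.ext (Leaf.pt_injective x ?_)
    rw [← hfy j, ← (hf j).apply_chartAt h2, show q i.1.pt = y from i.2]
  · intro r hr
    obtain ⟨g, hg, hrg⟩ := hsecB r hr
    let i : ι := ⟨⟨g (ψ y), hg.mem_leaf hq r hrg (mem_ball_self hδ)⟩,
      ψ.injOn (hg.mem_source _ (mem_ball_self hδ)) hy (hg.apply_eq _ (mem_ball_self hδ))⟩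
    refine mem_iUnion.2 ⟨i, ?_⟩
    change r.pt ∈ f i '' B
    rw [← hplaque g i _ hg ⟨ψ y, mem_ball_self hδ, rfl⟩ (hfi i)]
    exact hrg

end Covering

theorem lemma5p2
    {E E₁ E₂ : Type*}
    [NormedAddCommGroup E] [NormedSpace ℂ E] [FiniteDimensional ℂ E]
    [NormedAddCommGroup E₁] [NormedSpace ℂ E₁] [FiniteDimensional ℂ E₁]
    [NormedAddCommGroup E₂] [NormedSpace ℂ E₂] [FiniteDimensional ℂ E₂]
    {X Y₁ Y₂ : Type*}
    [TopologicalSpace X] [T2Space X] [ChartedSpace E X] [IsManifold 𝓘(ℂ, E) ω X]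
    [TopologicalSpace Y₁] [T2Space Y₁] [ChartedSpace E₁ Y₁] [IsManifold 𝓘(ℂ, E₁) ω Y₁]
    [TopologicalSpace Y₂] [T2Space Y₂] [ChartedSpace E₂ Y₂] [IsManifold 𝓘(ℂ, E₂) ω Y₂]
    (φ : X → Y₁ × Y₂)
    (hφ_holo : ContMDiff 𝓘(ℂ, E) (𝓘(ℂ, E₁).prod 𝓘(ℂ, E₂)) ω φ)
    (hφ_proper : IsProperMap φ)
    (hφ_surj : Function.Surjective φ)
    (hq_submersion : ∀ x : X,
      Function.Surjective (mfderiv 𝓘(ℂ, E) 𝓘(ℂ, E₂) (fun z => (φ z).2) x))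
    (V : ∀ x : X, Submodule ℂ (TangentSpace 𝓘(ℂ, E) x))
    (hV : IsIntegrableConnection (F := E₂) (fun z => (φ z).2) V)
    (hleaf : ∀ x : X, ∃ y₁ : Y₁, φ '' leaf V x = {y₁} ×ˢ Set.univ) :
    ∀ x : X, IsEtaleCoveringOnLeaf (F := E₂) (fun z => (φ z).2) V x := by
  intro x
  have : CompleteSpace E := FiniteDimensional.complete ℂ E
  have : CompleteSpace E₂ := FiniteDimensional.complete ℂ E₂
  have hq : ContMDiff 𝓘(ℂ, E) 𝓘(ℂ, E₂) ω fun z => (φ z).2 := contMDiff_snd.comp hφ_holo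
  obtain ⟨y₁, hy₁⟩ := hleaf x
  have hfst : ∀ p : Leaf V x, φ p.pt = (y₁, (φ p.pt).2) := fun p => by
    have h1 : φ p.pt ∈ {y₁} ×ˢ Set.univ := hy₁ ▸ ⟨p.pt, p.mem, rfl⟩
    exact Prod.ext h1.1 rfl
  have hsurj : Function.Surjective fun p : Leaf V x => (φ p.pt).2 := fun y => by
    obtain ⟨a, ha, hay⟩ : (y₁, y) ∈ φ '' leaf V x := hy₁ ▸ ⟨rfl, trivial⟩
    exact ⟨⟨a, ha⟩, congrArg Prod.snd hay⟩
  refine ⟨hsurj, fun y => ?_, Leaf.exists_isLeafAtlas hq hq_submersion hV x,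
    fun _ h => h.isLocalDiffeomorph hq hq_submersion hV.isCompl⟩
  -- the points of the leaf over `y` lie in the compact fibre of `φ` over `(y₁, y)`
  obtain ⟨ε, hε, hsec⟩ := IsCompact.exists_isHorizontalSection hq hq_submersion hV
    (hφ_proper.isCompact_preimage (isCompact_singleton (x := (y₁, y)))) (y := y)
    fun z hz => congrArg Prod.snd (show φ z = (y₁, y) from hz)
  have hnear := hφ_proper.isClosedMap.eventually_nhds_fiber (y₁, y)
    fun z hz => eventually_nhdsSet_iff_forall.1 hsec z hz
  refine Leaf.isEvenlyCovered hq hq_submersion hV hε ?_ (hsurj y)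
  filter_upwards [(Continuous.prodMk_right y₁).continuousAt.eventually hnear] with z hz p hp
  have h1 := hz p.pt (by rw [Set.mem_preimage, hfst p, hp]; rfl)
  rwa [hp] at h1
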